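/- **Setting.** Let $d,C\ge 0$ and $N\ge 1$ be integers. Let $\mathcal{Y}$ be a measurable space and $\mathcal{D}$ a probability distribution on $\mathbb{R}^d\times\mathcal{Y}$. Let $\ell:\mathbb{R}^C\times\mathcal{Y}\to[0,E]$ be a measurable loss which is $\lambda$-Lipschitz in its first argument with respect to the $L^\infty$ norm, where $\lambda\ge 0$. Let $(x_1,y_1),\dots,(x_N,y_N)$ be i.i.d. samples from $\mathcal{D}$ and put $\mathfrak{B}=\max_{i\le N}\|x_i\|_2$. A *linear network* of depth $L\ge1$ and width $w$ is a map $x\mapsto Ax=B_LB_{L-1}\cdots B_1x$ with $B_1\in\mathbb{R}^{w\times d}$, $B_2,\dots,B_{L-1}\in\mathbb{R}^{w\times w}$, $B_L\in\mathbb{R}^{C\times w}$ (for $L=1$: $A=B_1\in\mathbb{R}^{C\times d}$). Its generalization gap is $$\mathrm{GAP}(A)=\mathbb{E}_{(x,y)\sim\mathcal{D}}[\ell(Ax,y)]-\frac1N\sum_{i=1}^N\ell(Ax_i,y_i).$$ Let $\|A\|$ be the spectral norm and, for $p>0$, let $\|A\|_{S_p}=\big(\sum_i\sigma_i(A)^p\big)^{1/p}$,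 where $\sigma_i(A)$ are the singular values. For a network of depth $L$ put $p=2/L$. **Theorem.** (1) There are universal constants $c_1,c_2\in\mathbb{R}$ and $k\in\mathbb{N}$ such that, in every such setting and for every $\delta\in(0,1)$, with probability at least $1-\delta$ over the sample, the following holds simultaneously for all widths $w$, all depths $L$ and all linear networks $A=B_L\cdots B_1$. With $$\Lambda=c_2\,(E+1)\,\big[\log(3+N+C+d+\lambda+\mathfrak{B}+\|A\|)\big]^k,$$ $$\mathrm{GAP}(A)-c_1E\sqrt{\frac{\log(2/\delta)}{N}}\;\le\;\Lambda\sqrt{\frac{[\lambda\mathfrak{B}]^{\frac{2p}{2+p}}\|A\|_{S_p}^{\frac{2p}{2+p}}\min(C,d)^{\frac{p}{p+2}}(C+d)^{\frac{2}{p+2}}}{N}}\;\le\;\Lambda\sqrt{[\lambda\mathfrak{B}]^{\frac{2}{L+1}}\,\frac{\big[\sum_{\ell=1}^L\|B_\ell\|_F^2\big]^{\frac{L}{L+1}}(C+d)}{N\,L^{\frac{L}{L+1}}}}.$$ (2) For all $L\ge1$, $w\ge\min(C,d)$ and $A\in\mathbb{R}^{C\times d}$, the minimum of $\sum_{\ell=1}^L\|B_\ell\|_F^2$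 over all factorizations $A=B_L\cdots B_1$ of depth $L$ and width $w$ is attained and equals $L\|A\|_{S_{2/L}}^{2/L}$. (3) Let $w\ge\min(C,d)$ and $A\in\mathbb{R}^{C\times d}$ be fixed and, for each $L\ge 1$, let $B_1,\dots,B_L$ (depending on $L$) be a factorization of $A$ of depth $L$ and width $w$ which minimizes $\sum_{\ell}\|B_\ell\|_F^2$. Then, as $L\to\infty$, $\frac1L\sum_\ell\|B_\ell\|_F^2\to\mathrm{rank}(A)$. Moreover, for every fixed $a>0$ (in the place of $\lambda\mathfrak{B}$), with $p=2/L$, both $$a^{\frac{2p}{2+p}}\|A\|_{S_p}^{\frac{2p}{2+p}}\min(C,d)^{\frac{p}{p+2}}(C+d)^{\frac{2}{p+2}}\quad\text{and}\quad a^{\frac{2}{L+1}}\frac{\big[\sum_\ell\|B_\ell\|_F^2\big]^{\frac{L}{L+1}}(C+d)}{L^{\frac{L}{L+1}}}$$ converge to the parameter count $(C+d)\,\mathrm{rank}(A)$. -/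

import Mathlib

open MeasureTheory Filter Topology
open scoped Matrix

noncomputable section

/-- Factor matrices `B_1, …, B_L` of a linear network from `ℝ^d` to `ℝ^C` with hidden width `w`.
For depth one there is a single `C × d` matrix. For depth `L = k + 2` these are
`B_L = Bout`, `B_{j+2} = Bmid j` for `j < k`, and `B_1 = Bin`. -/
inductive LinearNetwork (d C w : ℕ) : Type
  | shallow (B : Matrix (Fin C) (Fin d) ℝ) : LinearNetwork d C w
  | deep (k : ℕ) (Bout : Matrix (Fin C) (Fin w) ℝ) (Bmid : Fin k → Matrix (Fin w) (Fin w) ℝ)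
      (Bin : Matrix (Fin w) (Fin d) ℝ) : LinearNetwork d C w

/-- The squared Frobenius norm. -/
def frobSq {m n : ℕ} (B : Matrix (Fin m) (Fin n) ℝ) : ℝ := ∑ i, ∑ j, B i j ^ 2

/-- The spectral norm, the operator norm with respect to Euclidean norms. -/
def spectralNorm2 {m n : ℕ} (A : Matrix (Fin m) (Fin n) ℝ) : ℝ :=
  ‖LinearMap.toContinuousLinearMap A.toEuclideanLin‖

/-- The Schatten `p` quasi-norm `(∑ᵢ σᵢ(A)^p)^(1/p)`, for `p > 0`. -/
def schattenNorm {m n : ℕ} (p : ℝ) (A : Matrix (Fin m) (Fin n) ℝ) : ℝ :=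
  (∑ i ∈ Finset.range (min m n), (A.toEuclideanLin.singularValues i) ^ p) ^ (1 / p)

namespace LinearNetwork

variable {d C w : ℕ}

/-- The number `L` of factor matrices. -/
def depth : LinearNetwork d C w → ℕ
  | shallow _ => 1
  | deep k _ _ _ => k + 2

/-- The end-to-end matrix `A = B_L ⋯ B_1`. -/
def toMatrix : LinearNetwork d C w → Matrix (Fin C) (Fin d) ℝ
  | shallow B => B
  | deep _ Bout Bmid Bin => Bout * (List.ofFn Bmid).reverse.prod * Bin

/-- The sum `∑_ℓ ‖B_ℓ‖_F²` of the squared Frobenius norms of the factors. -/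
def weightSq : LinearNetwork d C w → ℝ
  | shallow B => frobSq B
  | deep _ Bout Bmid Bin => frobSq Bout + (∑ j, frobSq (Bmid j)) + frobSq Bin

/-- The index `p = 2 / L`. -/
def index (F : LinearNetwork d C w) : ℝ := 2 / (F.depth : ℝ)

/-- With `A` the end-to-end matrix and `p = 2 / L`, the quantity
`a^(2p/(2+p)) ‖A‖_{S_p}^(2p/(2+p)) min(C,d)^(p/(p+2)) (C+d)^(2/(p+2))`. -/
def schattenRate (F : LinearNetwork d C w) (a : ℝ) : ℝ :=
  a ^ (2 * F.index / (2 + F.index)) *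
    schattenNorm F.index F.toMatrix ^ (2 * F.index / (2 + F.index)) *
    (min C d : ℝ) ^ (F.index / (F.index + 2)) *
    ((C : ℝ) + d) ^ (2 / (F.index + 2))

/-- The quantity `a^(2/(L+1)) (∑_ℓ ‖B_ℓ‖_F²)^(L/(L+1)) (C+d) / L^(L/(L+1))`. -/
def factorRate (F : LinearNetwork d C w) (a : ℝ) : ℝ :=
  a ^ (2 / ((F.depth : ℝ) + 1)) *
    (F.weightSq ^ ((F.depth : ℝ) / (F.depth + 1)) * ((C : ℝ) + d)) /
    (F.depth : ℝ) ^ ((F.depth : ℝ) / (F.depth + 1))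

end LinearNetwork

/-- The generalization gap of the linear map `x ↦ A x`: its expected loss minus its
average loss over the sample `S`. -/
def genGap {d C N : ℕ} {Y : Type*} [MeasurableSpace Y]
    (D : Measure (EuclideanSpace ℝ (Fin d) × Y)) (loss : (Fin C → ℝ) → Y → ℝ)
    (S : Fin N → EuclideanSpace ℝ (Fin d) × Y) (A : Matrix (Fin C) (Fin d) ℝ) : ℝ :=
  (∫ z, loss (A *ᵥ z.1.ofLp) z.2 ∂D) - (1 / (N : ℝ)) * ∑ i, loss (A *ᵥ (S i).1.ofLp) (S i).2

/-- The largest Euclidean norm of an input of the sample. -/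
def sampleRadius {d N : ℕ} {Y : Type*} (S : Fin N → EuclideanSpace ℝ (Fin d) × Y) : ℝ :=
  ⨆ i, ‖(S i).1‖

/-- The polylogarithmic factor `log(3 + N + C + d + lam + b + s)^k`. -/
def polylogFactor (k N C d : ℕ) (lam b s : ℝ) : ℝ :=
  Real.log (3 + N + C + d + lam + b + s) ^ k

end

/-!
# Generalization of linear networks at the rate of a Schatten quasi-norm

**The variational identity.** Start from the right singular vectors of `A = B_L ⋯ B_1` belonging to
positive singular values, and orthogonalize their images under `B_t ⋯ B_1` for every `t` by
Gram–Schmidt. In the resulting orthonormal families each layer is triangular, and its diagonal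
entries are the ratios of consecutive Gram–Schmidt norms. The squares of these entries sum to at
most `‖B_t‖_F²` (`sum_gramSchmidt_ratio_sq_le_frobSq`), and for each `i` their product over the
layers telescopes to `σᵢ(A)` (`exists_ratios_of_network`), so that the inequality of arithmetic and
geometric means gives `L ∑ᵢ σᵢ^(2/L) ≤ ∑ₜ ‖B_t‖_F²`. Equality holds for the balanced factorization,
all of whose layers have singular values `σᵢ^(1/L)` (`exists_network_weightSq_eq`). The comparison
of the two rates and the limits `L → ∞` follow, since `σ^(2/L) → 1` exactly when `σ > 0`.

**The generalization bound.** Let `R` be a quantile of level `log(2/δ)/N` of `‖x‖`. With high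
probability `R` is at most the sample radius (`measure_sampleRadius_lt_le`), and setting the loss to
zero where `‖x‖ > R` costs at most `E log(2/δ)/N` (`genGap_le_empGap_truncLoss`). The truncated loss
is Lipschitz in the output in the maximum norm only, but for a fixed input a Gaussian perturbation
of the matrix at scale `a` moves it on average by at most `λ R a` up to a logarithm of `C`
(`abs_truncLoss_sub_smooth_le`). For a fixed center `M`, the PAC-Bayes inequality with Gaussian
prior at `M` and posterior at `A` involves only the relative entropy `‖A - M‖²/(2a²)`
(`integral_gauss_le_of_exp_le`); it is used for the difference of smoothings at two consecutive
dyadic scales and summed over the scales. This chaining (`measure_chaining_le`) bounds the gap at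
every `A` by `λ R ‖A - M‖_F / √N` plus `E √(log(1/(δ w(M))) / N)`, up to logarithms and
simultaneously for countably many centers `M` with prior weights `w(M)`.

The centers are the products of two factors with entries on a dyadic grid. A center of rank `k` has
`log(1/w(M))` of order `k (C + d)`, up to logarithms. Splitting the singular values of `A` at a
threshold `τ` leaves `k ≤ ‖A‖_{S_p}^p τ^(-p)` large ones and a remainder of squared Frobenius norm
at most `min(C, d) τ²` (`exists_threshold_decomposition`). The threshold at which
`λ² 𝔅² min(C, d) τ²` equals `‖A‖_{S_p}^p τ^(-p) (C + d)` makes both of them the Schatten rate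
(`LinearNetwork.exists_balanced_decomposition`).
-/

/-! ### Frobenius norms and orthonormal families -/

lemma frobSq_nonneg {m n : ℕ} (B : Matrix (Fin m) (Fin n) ℝ) : 0 ≤ frobSq B :=
  Finset.sum_nonneg fun _ _ => Finset.sum_nonneg fun _ _ => sq_nonneg _

/-- The `a`-th row of `B` as a Euclidean vector. -/
noncomputable def rowVec {m n : ℕ} (B : Matrix (Fin m) (Fin n) ℝ) (a : Fin m) :
    EuclideanSpace ℝ (Fin n) := WithLp.toLp 2 (B a)

lemma toEuclideanLin_apply_eq_inner {m n : ℕ} (B : Matrix (Fin m) (Fin n) ℝ)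
    (x : EuclideanSpace ℝ (Fin n)) (a : Fin m) :
    B.toEuclideanLin x a = inner ℝ (rowVec B a) x := by
  simp [rowVec, Matrix.mulVec, dotProduct, PiLp.inner_apply, mul_comm]

lemma frobSq_eq_sum_rowVec {m n : ℕ} (B : Matrix (Fin m) (Fin n) ℝ) :
    frobSq B = ∑ a, ‖rowVec B a‖ ^ 2 := by
  simp [frobSq, EuclideanSpace.norm_sq_eq, rowVec]

lemma norm_toEuclideanLin_sq {m n : ℕ} (B : Matrix (Fin m) (Fin n) ℝ)
    (x : EuclideanSpace ℝ (Fin n)) :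
    ‖B.toEuclideanLin x‖ ^ 2 = ∑ a, (inner ℝ (rowVec B a) x) ^ 2 := by
  simp only [EuclideanSpace.norm_sq_eq, Real.norm_eq_abs, sq_abs, toEuclideanLin_apply_eq_inner]

lemma frobSq_eq_sum_basis {m n : ℕ} {ι : Type*} [Fintype ι] (B : Matrix (Fin m) (Fin n) ℝ)
    (b : OrthonormalBasis ι ℝ (EuclideanSpace ℝ (Fin n))) :
    frobSq B = ∑ i, ‖B.toEuclideanLin (b i)‖ ^ 2 := by
  simp only [norm_toEuclideanLin_sq]
  rw [Finset.sum_comm, frobSq_eq_sum_rowVec]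
  refine Finset.sum_congr rfl fun a _ => ?_
  rw [← b.sum_sq_norm_inner_left]
  simp

lemma sum_norm_sq_le_frobSq {m n : ℕ} {ι : Type*} [Fintype ι] (B : Matrix (Fin m) (Fin n) ℝ)
    {e : ι → EuclideanSpace ℝ (Fin n)} (he : Orthonormal ℝ e) :
    ∑ i, ‖B.toEuclideanLin (e i)‖ ^ 2 ≤ frobSq B := by
  simp only [norm_toEuclideanLin_sq]
  rw [Finset.sum_comm, frobSq_eq_sum_rowVec]
  refine Finset.sum_le_sum fun a _ => ?_
  have := he.sum_inner_products_le (rowVec B a) (s := Finset.univ)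
  simpa [real_inner_comm] using this

/-! ### The singular value decomposition -/

/-- Right singular vectors: an orthonormal basis which a linear map sends to an orthogonal family
whose norms are the singular values. -/
lemma exists_singular_basis {m n : ℕ}
    (T : EuclideanSpace ℝ (Fin n) →ₗ[ℝ] EuclideanSpace ℝ (Fin m)) :
    ∃ v : OrthonormalBasis (Fin n) ℝ (EuclideanSpace ℝ (Fin n)), ∀ i j,
      inner ℝ (T (v i)) (T (v j)) = if i = j then (T.singularValues i) ^ 2 else 0 := by
  have hn : Module.finrank ℝ (EuclideanSpace ℝ (Fin n)) = n := by simp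
  refine ⟨T.isSymmetric_adjoint_comp_self.eigenvectorBasis hn, fun i j => ?_⟩
  rw [← LinearMap.adjoint_inner_right]
  have := T.isSymmetric_adjoint_comp_self.apply_eigenvectorBasis hn j
  rw [LinearMap.comp_apply] at this
  rw [this, inner_smul_right, OrthonormalBasis.inner_eq_ite]
  split_ifs with h
  · subst h; simp [T.sq_singularValues_fin hn]
  · simp

lemma norm_singular_apply {m n : ℕ} {T : EuclideanSpace ℝ (Fin n) →ₗ[ℝ] EuclideanSpace ℝ (Fin m)}
    {v : OrthonormalBasis (Fin n) ℝ (EuclideanSpace ℝ (Fin n))}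
    (hv : ∀ i j, inner ℝ (T (v i)) (T (v j)) = if i = j then (T.singularValues i) ^ 2 else 0)
    (i : Fin n) : ‖T (v i)‖ = T.singularValues i := by
  have := hv i i
  rw [real_inner_self_eq_norm_sq, if_pos rfl] at this
  exact (sq_eq_sq₀ (norm_nonneg _) (T.singularValues_nonneg i)).1 this

lemma finrank_range_toEuclideanLin {m n : ℕ} (A : Matrix (Fin m) (Fin n) ℝ) :
    Module.finrank ℝ (LinearMap.range A.toEuclideanLin) = A.rank := by
  rw [Matrix.toEuclideanLin_eq_toLin_orthonormal, ← Matrix.rank_eq_finrank_range_toLin]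

lemma singularValues_pos_iff_lt_rank {m n : ℕ} (A : Matrix (Fin m) (Fin n) ℝ) (i : ℕ) :
    0 < A.toEuclideanLin.singularValues i ↔ i < A.rank := by
  rw [LinearMap.singularValues_pos_iff_lt_finrank_range, finrank_range_toEuclideanLin]

lemma rank_le_min {m n : ℕ} (A : Matrix (Fin m) (Fin n) ℝ) : A.rank ≤ min m n :=
  le_min (by simpa using A.rank_le_height) (by simpa using A.rank_le_width)

lemma singularValues_eq_zero_of_rank_le {m n : ℕ} (A : Matrix (Fin m) (Fin n) ℝ) {i : ℕ}
    (h : A.rank ≤ i) : A.toEuclideanLin.singularValues i = 0 := by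
  rw [LinearMap.singularValues_eq_zero_iff_le_finrank_range, finrank_range_toEuclideanLin]
  exact h

/-! ### Gram–Schmidt along a linear map -/

section GramSchmidt

variable {E F : Type*} [NormedAddCommGroup E] [InnerProductSpace ℝ E]
  [NormedAddCommGroup F] [InnerProductSpace ℝ F] {r : ℕ}

open InnerProductSpace

lemma inner_gramSchmidt_map_eq_zero (f : E →ₗ[ℝ] F) (v : Fin r → E) (i : Fin r) {x : E}
    (hx : x ∈ Submodule.span ℝ (v '' Set.Iio i)) :
    inner ℝ (gramSchmidt ℝ (f ∘ v) i) (f x) = 0 := by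
  induction hx using Submodule.span_induction with
  | mem x hx =>
    obtain ⟨j, hj, rfl⟩ := hx
    exact gramSchmidt_inv_triangular ℝ (f ∘ v) hj
  | zero => simp
  | add x y _ _ hx hy => simp [inner_add_right, hx, hy]
  | smul c x _ hx => simp [inner_smul_right, hx]

lemma sub_gramSchmidt_mem_span (v : Fin r → E) (i : Fin r) :
    v i - gramSchmidt ℝ v i ∈ Submodule.span ℝ (v '' Set.Iio i) := by
  rw [← span_gramSchmidt_Iio ℝ v i]
  nth_rewrite 1 [gramSchmidt_def' ℝ v i]
  rw [add_sub_cancel_left]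
  refine Submodule.sum_mem _ fun j hj => ?_
  rw [Submodule.starProjection_singleton]
  exact Submodule.smul_mem _ _ (Submodule.subset_span ⟨j, Finset.mem_Iio.1 hj, rfl⟩)

lemma inner_gramSchmidt_self (v : Fin r → E) (i : Fin r) :
    inner ℝ (gramSchmidt ℝ v i) (v i) = ‖gramSchmidt ℝ v i‖ ^ 2 := by
  have := inner_gramSchmidt_map_eq_zero LinearMap.id v i (sub_gramSchmidt_mem_span v i)
  simp only [LinearMap.id_coe, Function.id_comp, id, inner_sub_right] at this
  rw [← real_inner_self_eq_norm_sq]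
  linarith

/-- The triangular factor of a linear map between Gram–Schmidt bases has the ratios of the
Gram–Schmidt norms on its diagonal. -/
lemma inner_gramSchmidtNormed_map (f : E →ₗ[ℝ] F) (v : Fin r → E) (i : Fin r) :
    inner ℝ (gramSchmidtNormed ℝ (f ∘ v) i) (f (gramSchmidtNormed ℝ v i)) =
      ‖gramSchmidt ℝ (f ∘ v) i‖ / ‖gramSchmidt ℝ v i‖ := by
  have h1 := inner_gramSchmidt_map_eq_zero f v i (sub_gramSchmidt_mem_span v i)
  have h2 := inner_gramSchmidt_self (f ∘ v) i
  simp only [map_sub, inner_sub_right, Function.comp_apply] at h1 h2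
  have h3 : inner ℝ (gramSchmidt ℝ (f ∘ v) i) (f (gramSchmidt ℝ v i)) =
      ‖gramSchmidt ℝ (f ∘ v) i‖ ^ 2 := by linarith
  simp only [gramSchmidtNormed, map_smul, inner_smul_left, inner_smul_right, h3]
  simp only [RCLike.ofReal_real_eq_id, id, conj_trivial]
  by_cases h : ‖gramSchmidt ℝ (f ∘ v) i‖ = 0
  · simp [h]
  · field_simp

end GramSchmidt

open InnerProductSpace in
/-- One layer of the variational lower bound: the ratios are diagonal entries of `B` in two
orthonormal families, hence at most the norms of the images of the first family, and Bessel's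
inequality applies to the rows of `B`. -/
lemma sum_gramSchmidt_ratio_sq_le_frobSq {m n r : ℕ} (B : Matrix (Fin m) (Fin n) ℝ)
    (v : Fin r → EuclideanSpace ℝ (Fin n)) (hv : LinearIndependent ℝ v)
    (hBv : LinearIndependent ℝ (B.toEuclideanLin ∘ v)) :
    ∑ i, (‖gramSchmidt ℝ (B.toEuclideanLin ∘ v) i‖ / ‖gramSchmidt ℝ v i‖) ^ 2 ≤ frobSq B := by
  refine le_trans (Finset.sum_le_sum fun i _ => ?_)
    (sum_norm_sq_le_frobSq B (gramSchmidtNormed_orthonormal hv))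
  rw [← inner_gramSchmidtNormed_map]
  have h := abs_real_inner_le_norm (gramSchmidtNormed ℝ (B.toEuclideanLin ∘ v) i)
    (B.toEuclideanLin (gramSchmidtNormed ℝ v i))
  rw [(gramSchmidtNormed_orthonormal hBv).1 i, one_mul] at h
  rw [← sq_abs]
  gcongr

/-! ### The variational identity -/

lemma toEuclideanLin_mul_apply {l m n : ℕ} (A : Matrix (Fin l) (Fin m) ℝ)
    (B : Matrix (Fin m) (Fin n) ℝ) (x : EuclideanSpace ℝ (Fin n)) :
    (A * B).toEuclideanLin x = A.toEuclideanLin (B.toEuclideanLin x) := by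
  ext i
  simp [Matrix.mulVec_mulVec]

lemma toEuclideanLin_mul_comp {l m n : ℕ} {ι : Type*} (A : Matrix (Fin l) (Fin m) ℝ)
    (B : Matrix (Fin m) (Fin n) ℝ) (v : ι → EuclideanSpace ℝ (Fin n)) :
    (A * B).toEuclideanLin ∘ v = A.toEuclideanLin ∘ (B.toEuclideanLin ∘ v) := by
  funext i
  exact toEuclideanLin_mul_apply A B (v i)

section LowerBound

open InnerProductSpace

/-- The Gram–Schmidt norms of the images of `v` under successive layers telescope. -/
lemma exists_ratios_of_square_layers {w r : ℕ} (k : ℕ) (Bmid : Fin k → Matrix (Fin w) (Fin w) ℝ)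
    (v : Fin r → EuclideanSpace ℝ (Fin w)) (hv : LinearIndependent ℝ v)
    (h : LinearIndependent ℝ ((List.ofFn Bmid).reverse.prod.toEuclideanLin ∘ v)) :
    ∃ ρ : Fin k → Fin r → ℝ, (∀ t i, 0 ≤ ρ t i) ∧
      (∀ i, ∏ t, ρ t i = ‖gramSchmidt ℝ ((List.ofFn Bmid).reverse.prod.toEuclideanLin ∘ v) i‖ /
        ‖gramSchmidt ℝ v i‖) ∧
      ∀ t, ∑ i, ρ t i ^ 2 ≤ frobSq (Bmid t) := by
  induction k with
  | zero =>
    refine ⟨fun _ _ => 0, by simp, fun i => ?_, fun t => t.elim0⟩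
    have h1 : ((List.ofFn Bmid).reverse.prod.toEuclideanLin ∘ v) = v := by
      funext i; ext j; simp
    rw [h1, div_self (norm_ne_zero_iff.2 (gramSchmidt_ne_zero i hv))]
    simp
  | succ k ih =>
    have e : (List.ofFn Bmid).reverse.prod =
        Bmid (Fin.last k) * (List.ofFn fun t : Fin k => Bmid t.castSucc).reverse.prod := by
      rw [List.ofFn_succ', List.concat_eq_append, List.reverse_append]
      simp
    rw [e, toEuclideanLin_mul_comp] at h ⊢
    have h' := LinearIndependent.of_comp _ h
    obtain ⟨ρ, h0, h1, h2⟩ := ih (fun t : Fin k => Bmid t.castSucc) h'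
    refine ⟨Fin.snoc ρ fun i =>
      ‖gramSchmidt ℝ ((Bmid (Fin.last k)).toEuclideanLin ∘
        ((List.ofFn fun t : Fin k => Bmid t.castSucc).reverse.prod.toEuclideanLin ∘ v)) i‖ /
      ‖gramSchmidt ℝ ((List.ofFn fun t : Fin k =>
        Bmid t.castSucc).reverse.prod.toEuclideanLin ∘ v) i‖, fun t => ?_, fun i => ?_, fun t => ?_⟩
    · refine Fin.lastCases ?_ (fun t => ?_) t
      · simp only [Fin.snoc_last]; intro i; positivity
      · simpa only [Fin.snoc_castSucc] using h0 t
    · rw [Fin.prod_univ_castSucc]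
      simp only [Fin.snoc_last, Fin.snoc_castSucc]
      rw [h1, mul_comm, div_mul_div_cancel₀ (norm_ne_zero_iff.2 (gramSchmidt_ne_zero i h'))]
    · refine Fin.lastCases ?_ (fun t => ?_) t
      · simp only [Fin.snoc_last]
        exact sum_gramSchmidt_ratio_sq_le_frobSq _ _ h' h
      · simpa only [Fin.snoc_castSucc] using h2 t

/-- Along the layers of a network, the ratios of consecutive Gram–Schmidt norms are controlled by
the Frobenius norms of the layers, and multiply to the overall ratio. -/
lemma exists_ratios_of_network {d C w r L : ℕ} (F : LinearNetwork d C w) (hL : F.depth = L)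
    (v : Fin r → EuclideanSpace ℝ (Fin d)) (hv : LinearIndependent ℝ v)
    (h : LinearIndependent ℝ (F.toMatrix.toEuclideanLin ∘ v)) :
    ∃ ρ : Fin L → Fin r → ℝ, (∀ t i, 0 ≤ ρ t i) ∧
      (∀ i, ∏ t, ρ t i = ‖gramSchmidt ℝ (F.toMatrix.toEuclideanLin ∘ v) i‖ /
        ‖gramSchmidt ℝ v i‖) ∧
      ∑ t, ∑ i, ρ t i ^ 2 ≤ F.weightSq := by
  cases F with
  | shallow B =>
    simp only [LinearNetwork.toMatrix, LinearNetwork.depth, LinearNetwork.weightSq] at h hL ⊢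
    subst hL
    refine ⟨fun _ i => ‖gramSchmidt ℝ (B.toEuclideanLin ∘ v) i‖ / ‖gramSchmidt ℝ v i‖,
      fun _ _ => by positivity, fun i => by simp, ?_⟩
    simpa using sum_gramSchmidt_ratio_sq_le_frobSq B v hv h
  | deep k Bout Bmid Bin =>
    simp only [LinearNetwork.toMatrix, LinearNetwork.depth, LinearNetwork.weightSq] at h hL ⊢
    subst hL
    rw [Matrix.mul_assoc, toEuclideanLin_mul_comp, toEuclideanLin_mul_comp] at h ⊢
    have h1 := LinearIndependent.of_comp _ h
    have h2 := LinearIndependent.of_comp _ h1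
    obtain ⟨ρ, r0, r1, r2⟩ := exists_ratios_of_square_layers k Bmid _ h2 h1
    have s1 := sum_gramSchmidt_ratio_sq_le_frobSq Bin v hv h2
    have s2 := sum_gramSchmidt_ratio_sq_le_frobSq Bout _ h1 h
    set v1 := Bin.toEuclideanLin ∘ v
    set v2 := (List.ofFn Bmid).reverse.prod.toEuclideanLin ∘ v1
    set v3 := Bout.toEuclideanLin ∘ v2
    refine ⟨Fin.cons (fun i => ‖gramSchmidt ℝ v1 i‖ / ‖gramSchmidt ℝ v i‖)
      (Fin.snoc ρ fun i => ‖gramSchmidt ℝ v3 i‖ / ‖gramSchmidt ℝ v2 i‖), fun t => ?_, fun i => ?_,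
      ?_⟩
    · refine Fin.cases ?_ (fun t => ?_) t
      · simp only [Fin.cons_zero]; intro i; positivity
      · refine Fin.lastCases ?_ (fun t => ?_) t
        · simp only [Fin.cons_succ, Fin.snoc_last]; intro i; positivity
        · simpa only [Fin.cons_succ, Fin.snoc_castSucc] using r0 t
    · rw [Fin.prod_univ_succ, Fin.prod_univ_castSucc]
      simp only [Fin.cons_succ, Fin.cons_zero, Fin.snoc_last, Fin.snoc_castSucc]
      rw [r1]
      have a1 := norm_ne_zero_iff.2 (gramSchmidt_ne_zero i h1)
      have a2 := norm_ne_zero_iff.2 (gramSchmidt_ne_zero i h2)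
      field_simp
    · rw [Fin.sum_univ_succ, Fin.sum_univ_castSucc]
      simp only [Fin.cons_succ, Fin.cons_zero, Fin.snoc_last, Fin.snoc_castSucc]
      have := Finset.sum_le_sum fun t (_ : t ∈ Finset.univ) => r2 t
      linarith

end LowerBound

/-- The sum `∑ᵢ σᵢ^p` of the powers of the singular values, `‖A‖_{S_p}^p`. -/
noncomputable def schattenSum {m n : ℕ} (p : ℝ) (A : Matrix (Fin m) (Fin n) ℝ) : ℝ :=
  ∑ i ∈ Finset.range (min m n), (A.toEuclideanLin.singularValues i) ^ p

lemma schattenSum_nonneg {m n : ℕ} (p : ℝ) (A : Matrix (Fin m) (Fin n) ℝ) : 0 ≤ schattenSum p A :=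
  Finset.sum_nonneg fun _ _ => Real.rpow_nonneg (LinearMap.singularValues_nonneg _ _) _

lemma schattenNorm_rpow {m n : ℕ} (p q : ℝ) (A : Matrix (Fin m) (Fin n) ℝ) :
    schattenNorm p A ^ q = schattenSum p A ^ (q / p) := by
  rw [show schattenNorm p A = schattenSum p A ^ (1 / p) from rfl,
    ← Real.rpow_mul (schattenSum_nonneg p A), one_div_mul_eq_div]

lemma schattenNorm_rpow_self {m n : ℕ} {p : ℝ} (hp : p ≠ 0) (A : Matrix (Fin m) (Fin n) ℝ) :
    schattenNorm p A ^ p = schattenSum p A := by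
  rw [schattenNorm_rpow, div_self hp, Real.rpow_one]

/-- Only the positive singular values contribute. -/
lemma schattenSum_eq_sum_rank {m n : ℕ} {p : ℝ} (hp : p ≠ 0) (A : Matrix (Fin m) (Fin n) ℝ) :
    schattenSum p A = ∑ i ∈ Finset.range A.rank, (A.toEuclideanLin.singularValues i) ^ p := by
  rw [schattenSum]
  refine (Finset.sum_subset (Finset.range_mono (rank_le_min A)) fun i _ hi => ?_).symm
  rw [singularValues_eq_zero_of_rank_le A (by simpa using hi), Real.zero_rpow hp]

lemma LinearNetwork.depth_pos {d C w : ℕ} (F : LinearNetwork d C w) : 0 < F.depth := by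
  cases F <;> simp [LinearNetwork.depth]

/-- The lower bound of the variational identity, for every width: Gram–Schmidt along the layers,
started from the right singular vectors, and the inequality of arithmetic and geometric means. -/
lemma depth_mul_schattenSum_le_weightSq {d C w : ℕ} (F : LinearNetwork d C w) :
    (F.depth : ℝ) * schattenSum (2 / (F.depth : ℝ)) F.toMatrix ≤ F.weightSq := by
  have hL : (0 : ℝ) < F.depth := by exact_mod_cast F.depth_pos
  set A := F.toMatrix with hA
  obtain ⟨v, hv⟩ := exists_singular_basis A.toEuclideanLin
  have hr : A.rank ≤ d := by simpa using A.rank_le_width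
  let u : Fin A.rank → EuclideanSpace ℝ (Fin d) := fun i => v (Fin.castLE hr i)
  have hu : Orthonormal ℝ u := v.orthonormal.comp _ (Fin.castLE_injective hr)
  have hpos : ∀ i : Fin A.rank, 0 < A.toEuclideanLin.singularValues i := fun i =>
    (singularValues_pos_iff_lt_rank A i).2 i.2
  have hnorm : ∀ i : Fin A.rank, ‖A.toEuclideanLin (u i)‖ = A.toEuclideanLin.singularValues i :=
    fun i => norm_singular_apply hv (Fin.castLE hr i)
  have horth : Pairwise fun i j : Fin A.rank =>
      inner ℝ ((A.toEuclideanLin ∘ u) i) ((A.toEuclideanLin ∘ u) j) = 0 := by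
    intro i j hij
    have := hv (Fin.castLE hr i) (Fin.castLE hr j)
    rwa [if_neg fun h => hij (Fin.castLE_injective hr h)] at this
  have hne : ∀ i, (A.toEuclideanLin ∘ u) i ≠ 0 := fun i => by
    rw [← norm_ne_zero_iff, Function.comp_apply, hnorm]; exact (hpos i).ne'
  obtain ⟨ρ, r0, r1, r2⟩ := exists_ratios_of_network F rfl u hu.linearIndependent
    (linearIndependent_of_ne_zero_of_inner_eq_zero hne horth)
  have hprod : ∀ i : Fin A.rank, ∏ t, ρ t i = A.toEuclideanLin.singularValues i := fun i => by
    rw [r1, InnerProductSpace.gramSchmidt_of_orthogonal ℝ horth,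
      InnerProductSpace.gramSchmidt_of_orthogonal ℝ hu.2, hu.1 i, div_one]
    exact hnorm i
  refine le_trans ?_ r2
  rw [schattenSum_eq_sum_rank (by positivity), Finset.sum_range, Finset.mul_sum, Finset.sum_comm]
  refine Finset.sum_le_sum fun i _ => ?_
  have key := Real.geom_mean_le_arith_mean_weighted Finset.univ (fun _ : Fin F.depth =>
    1 / (F.depth : ℝ)) (fun t => ρ t i ^ 2) (fun _ _ => by positivity) (by simp [hL.ne'])
    (fun _ _ => sq_nonneg _)
  rw [Real.finsetProd_rpow _ _ fun _ _ => sq_nonneg _, Finset.prod_pow, hprod, ← Finset.mul_sum,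
    ← Real.rpow_natCast, ← Real.rpow_mul (hpos i).le] at key
  calc (F.depth : ℝ) * A.toEuclideanLin.singularValues i ^ (2 / (F.depth : ℝ))
      ≤ F.depth * (1 / F.depth * ∑ t, ρ t i ^ 2) := by
        gcongr
        rw [show (2 : ℝ) / F.depth = ((2 : ℕ) : ℝ) * (1 / F.depth) by push_cast; ring]
        exact key
    _ = _ := by field_simp

/-- The expansion `A = ∑ᵢ (A vᵢ) vᵢᵀ` in an orthonormal basis. -/
lemma matrix_eq_sum_basis {m n : ℕ} (A : Matrix (Fin m) (Fin n) ℝ)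
    (v : OrthonormalBasis (Fin n) ℝ (EuclideanSpace ℝ (Fin n))) (x : Fin m) (y : Fin n) :
    A x y = ∑ i, A.toEuclideanLin (v i) x * v i y := by
  have h := congrArg (fun z : EuclideanSpace ℝ (Fin n) => z y) (v.sum_repr' (rowVec A x))
  simp only [toEuclideanLin_apply_eq_inner]
  simpa [rowVec, real_inner_comm] using h.symm

lemma sum_fin_ite_lt {M : Type*} [AddCommMonoid M] {r w : ℕ} (h : r ≤ w) (g : ℕ → M) :
    ∑ a : Fin w, (if (a : ℕ) < r then g a else 0) = ∑ a ∈ Finset.range r, g a := by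
  rw [← Finset.sum_range fun a => if a < r then g a else 0, ← Finset.sum_filter]
  congr 1
  ext a; simp; omega

/-- The balanced factorization, which distributes the roots `σᵢ^(1/L)` of the singular values over
the layers. -/
lemma exists_network_weightSq_eq {d C w L : ℕ} (hw : min C d ≤ w) (hL : 1 ≤ L)
    (A : Matrix (Fin C) (Fin d) ℝ) :
    ∃ F : LinearNetwork d C w, F.depth = L ∧ F.toMatrix = A ∧
      F.weightSq = L * schattenSum (2 / (L : ℝ)) A := by
  obtain ⟨v, hv⟩ := exists_singular_basis A.toEuclideanLin
  have hnorm := norm_singular_apply hv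
  have hr : A.rank ≤ d := by simpa using A.rank_le_width
  have hrw : A.rank ≤ w := (rank_le_min A).trans hw
  obtain ⟨vN, hvN⟩ : ∃ vN : ℕ → EuclideanSpace ℝ (Fin d), ∀ i : Fin d, vN i = v i :=
    ⟨fun a => if h : a < d then v ⟨a, h⟩ else 0, fun i => by simp⟩
  have hnormN : ∀ a < d, ‖A.toEuclideanLin (vN a)‖ = A.toEuclideanLin.singularValues a :=
    fun a ha => by rw [hvN ⟨a, ha⟩]; exact hnorm ⟨a, ha⟩
  obtain rfl | hL2 := hL.eq_or_lt
  · refine ⟨.shallow A, rfl, rfl, ?_⟩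
    simp only [LinearNetwork.weightSq]
    rw [schattenSum_eq_sum_rank (by norm_num), frobSq_eq_sum_basis A v]
    simp only [hnorm]
    rw [← Finset.sum_range fun a => A.toEuclideanLin.singularValues a ^ 2,
      ← Finset.sum_subset (Finset.range_mono hr) fun i _ hi => by
        rw [singularValues_eq_zero_of_rank_le A (by simpa using hi)]; norm_num]
    simp
  · obtain ⟨k, rfl⟩ : ∃ k, L = k + 2 := ⟨L - 2, by omega⟩
    set σ := A.toEuclideanLin.singularValues with hσ
    have hpos : ∀ a < A.rank, 0 < σ a := fun a ha => (singularValues_pos_iff_lt_rank A a).2 ha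
    set s : ℝ := 1 / ((k + 2 : ℕ) : ℝ) with hs
    have hsq : ∀ a < A.rank, (σ a ^ s) ^ 2 = σ a ^ (2 / ((k + 2 : ℕ) : ℝ)) := fun a ha => by
      rw [← Real.rpow_natCast, ← Real.rpow_mul (hpos a ha).le, hs]
      congr 1
      push_cast
      ring
    let Bin : Matrix (Fin w) (Fin d) ℝ :=
      Matrix.of fun a y => if (a : ℕ) < A.rank then σ a ^ s * vN a y else 0
    let c : Fin w → ℝ := fun a => if (a : ℕ) < A.rank then σ a ^ s else 0
    let Bout : Matrix (Fin C) (Fin w) ℝ := Matrix.of fun x a =>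
      if (a : ℕ) < A.rank then σ a ^ s * (σ a)⁻¹ * A.toEuclideanLin (vN a) x else 0
    have hpow : ∀ a < A.rank, σ a ^ s * (σ a)⁻¹ * (σ a ^ s) ^ k * σ a ^ s = 1 := fun a ha => by
      have : (σ a ^ s) ^ (k + 2) = σ a := by
        rw [← Real.rpow_natCast, ← Real.rpow_mul (hpos a ha).le, hs,
          one_div_mul_cancel (by positivity), Real.rpow_one]
      calc _ = (σ a ^ s) ^ (k + 2) * (σ a)⁻¹ := by ring
        _ = 1 := by rw [this, mul_inv_cancel₀ (hpos a ha).ne']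
    refine ⟨.deep k Bout (fun _ => Matrix.diagonal c) Bin, rfl, ?_, ?_⟩
    · simp only [LinearNetwork.toMatrix, List.ofFn_const, List.reverse_replicate,
        List.prod_replicate, Matrix.diagonal_pow]
      ext x y
      rw [matrix_eq_sum_basis A v x y, Matrix.mul_apply]
      have h0 : ∀ a : Fin w, (Bout * Matrix.diagonal (c ^ k)) x a = Bout x a * (c ^ k) a :=
        fun a => Matrix.mul_diagonal _ _ _ _
      have h1 : ∀ a : Fin w, Bout x a * (c ^ k) a * Bin a y =
          if (a : ℕ) < A.rank then A.toEuclideanLin (vN a) x * vN a y else 0 := fun a => by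
        simp only [Bout, c, Bin, Pi.pow_apply, Matrix.of_apply]
        split_ifs with h
        · calc _ = (σ a ^ s * (σ a)⁻¹ * (σ a ^ s) ^ k * σ a ^ s) *
                (A.toEuclideanLin (vN a) x * vN a y) := by ring
            _ = _ := by rw [hpow a h, one_mul]
        · simp
      simp only [h0, h1, ← hvN]
      rw [sum_fin_ite_lt hrw fun a => A.toEuclideanLin (vN a) x * vN a y,
        ← Finset.sum_range fun a => A.toEuclideanLin (vN a) x * vN a y]
      refine Finset.sum_subset (Finset.range_mono hr) fun i hid hi => ?_
      have h0 := hnormN i (by simpa using hid)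
      rw [singularValues_eq_zero_of_rank_le A (by simpa using hi), norm_eq_zero] at h0
      simp [h0]
    · simp only [LinearNetwork.weightSq]
      have h1 : frobSq Bin = ∑ a ∈ Finset.range A.rank, σ a ^ (2 / ((k + 2 : ℕ) : ℝ)) := by
        rw [← sum_fin_ite_lt hrw fun a => σ a ^ (2 / ((k + 2 : ℕ) : ℝ)), frobSq]
        refine Finset.sum_congr rfl fun a _ => ?_
        simp only [Bin, Matrix.of_apply]
        split_ifs with h
        · have h2 : ‖vN a‖ ^ 2 = 1 := by
            rw [hvN ⟨a, h.trans_le hr⟩, v.orthonormal.1, one_pow]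
          rw [EuclideanSpace.norm_sq_eq] at h2
          simp only [Real.norm_eq_abs, sq_abs] at h2
          simp only [mul_pow, ← Finset.mul_sum, h2, hsq a h, mul_one]
        · simp
      have h3 : frobSq Bout = ∑ a ∈ Finset.range A.rank, σ a ^ (2 / ((k + 2 : ℕ) : ℝ)) := by
        rw [← sum_fin_ite_lt hrw fun a => σ a ^ (2 / ((k + 2 : ℕ) : ℝ)), frobSq, Finset.sum_comm]
        refine Finset.sum_congr rfl fun a _ => ?_
        simp only [Bout, Matrix.of_apply]
        split_ifs with h
        · have h2 := congrArg (· ^ 2) (hnormN a (h.trans_le hr))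
          simp only [EuclideanSpace.norm_sq_eq, Real.norm_eq_abs, sq_abs] at h2
          simp only [mul_pow, ← Finset.mul_sum, h2, hsq a h]
          rw [mul_assoc, inv_pow, inv_mul_cancel₀ (pow_ne_zero 2 (hpos a h).ne'), mul_one]
        · simp
      have h4 : frobSq (Matrix.diagonal c) =
          ∑ a ∈ Finset.range A.rank, σ a ^ (2 / ((k + 2 : ℕ) : ℝ)) := by
        rw [← sum_fin_ite_lt hrw fun a => σ a ^ (2 / ((k + 2 : ℕ) : ℝ)), frobSq]
        refine Finset.sum_congr rfl fun a _ => ?_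
        rw [Finset.sum_eq_single a (fun b _ hb => by
          rw [Matrix.diagonal_apply_ne _ hb.symm]; norm_num) (by simp), Matrix.diagonal_apply_eq]
        simp only [c]
        split_ifs with h
        · exact hsq a h
        · norm_num
      rw [h1, h3, h4, schattenSum_eq_sum_rank (by positivity)]
      simp only [Finset.sum_const, Finset.card_univ, Fintype.card_fin, nsmul_eq_mul]
      push_cast
      ring

/-- The variational characterization of the Schatten quasi-norms with index `2 / L`. -/
lemma isLeast_weightSq (d C w L : ℕ) (hw : min C d ≤ w) (hL : 1 ≤ L)
    (A : Matrix (Fin C) (Fin d) ℝ) :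
    IsLeast {t : ℝ | ∃ F : LinearNetwork d C w,
        F.depth = L ∧ F.toMatrix = A ∧ F.weightSq = t}
      ((L : ℝ) * schattenNorm (2 / (L : ℝ)) A ^ (2 / (L : ℝ))) := by
  rw [schattenNorm_rpow_self (by positivity)]
  constructor
  · exact exists_network_weightSq_eq hw hL A
  · rintro t ⟨F, rfl, rfl, rfl⟩
    exact depth_mul_schattenSum_le_weightSq F

/-! ### The two rates and their limits -/

namespace LinearNetwork

variable {d C w : ℕ}

/-- The exponents of the Schatten rate, written in the depth `L` instead of `p = 2 / L`. -/
lemma schattenRate_eq (F : LinearNetwork d C w) (a : ℝ) :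
    F.schattenRate a = a ^ (2 / ((F.depth : ℝ) + 1)) *
      schattenSum F.index F.toMatrix ^ ((F.depth : ℝ) / (F.depth + 1)) *
      (min C d : ℝ) ^ (1 / ((F.depth : ℝ) + 1)) *
      ((C : ℝ) + d) ^ ((F.depth : ℝ) / (F.depth + 1)) := by
  have hL : (0 : ℝ) < F.depth := by exact_mod_cast F.depth_pos
  rw [schattenRate, schattenNorm_rpow]
  have e1 : 2 * F.index / (2 + F.index) = 2 / ((F.depth : ℝ) + 1) := by
    rw [index]; field_simp
  have e2 : 2 / ((F.depth : ℝ) + 1) / F.index = F.depth / (F.depth + 1) := by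
    rw [index]; field_simp
  have e3 : F.index / (F.index + 2) = 1 / ((F.depth : ℝ) + 1) := by
    rw [index]; field_simp; ring
  have e4 : 2 / (F.index + 2) = (F.depth : ℝ) / (F.depth + 1) := by
    rw [index]; field_simp; ring
  rw [e1, e2, e3, e4]

lemma factorRate_eq (F : LinearNetwork d C w) (hF : 0 ≤ F.weightSq) (a : ℝ) :
    F.factorRate a = a ^ (2 / ((F.depth : ℝ) + 1)) *
      (F.weightSq / F.depth) ^ ((F.depth : ℝ) / (F.depth + 1)) * ((C : ℝ) + d) := by
  rw [factorRate, Real.div_rpow hF (by positivity)]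
  ring

lemma weightSq_nonneg (F : LinearNetwork d C w) : 0 ≤ F.weightSq := by
  cases F with
  | shallow B => exact frobSq_nonneg B
  | deep k Bout Bmid Bin =>
    have := Finset.sum_nonneg fun j (_ : j ∈ Finset.univ) => frobSq_nonneg (Bmid j)
    exact add_nonneg (add_nonneg (frobSq_nonneg _) this) (frobSq_nonneg _)

lemma schattenRate_nonneg (F : LinearNetwork d C w) {a : ℝ} (ha : 0 ≤ a) :
    0 ≤ F.schattenRate a := by
  rw [schattenRate_eq]
  have := schattenSum_nonneg F.index F.toMatrix
  positivity

lemma schattenRate_le_factorRate (F : LinearNetwork d C w) {a : ℝ} (ha : 0 ≤ a) :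
    F.schattenRate a ≤ F.factorRate a := by
  have hL : (0 : ℝ) < F.depth := by exact_mod_cast F.depth_pos
  rw [schattenRate_eq, factorRate_eq F F.weightSq_nonneg, mul_assoc _ (_ ^ _) (_ ^ _)]
  have h1 : schattenSum F.index F.toMatrix ≤ F.weightSq / F.depth := by
    rw [le_div_iff₀ hL, mul_comm]
    exact depth_mul_schattenSum_le_weightSq F
  have h0 := schattenSum_nonneg F.index F.toMatrix
  have h2 : (min C d : ℝ) ^ (1 / ((F.depth : ℝ) + 1)) *
      ((C : ℝ) + d) ^ ((F.depth : ℝ) / (F.depth + 1)) ≤ (C : ℝ) + d := by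
    have hC : (0 : ℝ) ≤ C := C.cast_nonneg
    have hd : (0 : ℝ) ≤ d := d.cast_nonneg
    calc _ ≤ ((C : ℝ) + d) ^ (1 / ((F.depth : ℝ) + 1)) *
          ((C : ℝ) + d) ^ ((F.depth : ℝ) / (F.depth + 1)) := by
          gcongr
          exact (min_le_left _ _).trans (by linarith)
      _ = _ := by
          rw [← Real.rpow_add_of_nonneg (by positivity) (by positivity) (by positivity),
            ← add_div, add_comm (1 : ℝ), div_self (by positivity), Real.rpow_one]
  have h3 : 0 ≤ F.weightSq / F.depth := h0.trans h1
  gcongr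

end LinearNetwork

/-- As the exponent tends to zero, each positive singular value contributes one. -/
lemma tendsto_schattenSum {m n : ℕ} (A : Matrix (Fin m) (Fin n) ℝ) :
    Tendsto (fun L : ℕ => schattenSum (2 / (L : ℝ)) A) atTop (𝓝 (A.rank : ℝ)) := by
  have h1 : Tendsto (fun L : ℕ => ∑ i ∈ Finset.range A.rank,
      (A.toEuclideanLin.singularValues i) ^ (2 / (L : ℝ))) atTop
      (𝓝 (∑ i ∈ Finset.range A.rank, (1 : ℝ))) := by
    refine tendsto_finsetSum _ fun i hi => ?_
    have hpos := (singularValues_pos_iff_lt_rank A i).2 (by simpa using hi)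
    have := (Real.continuousAt_const_rpow
      (a := A.toEuclideanLin.singularValues i) hpos.ne').tendsto.comp
      (tendsto_const_div_atTop_nhds_zero_nat (2 : ℝ))
    simpa [Function.comp_def] using this
  simp only [Finset.sum_const, Finset.card_range, nsmul_eq_mul, mul_one] at h1
  refine h1.congr' ?_
  filter_upwards [eventually_ge_atTop 1] with L hL
  rw [schattenSum_eq_sum_rank (by positivity)]

lemma tendsto_depth_ratio :
    Tendsto (fun L : ℕ => (L : ℝ) / (L + 1)) atTop (𝓝 1) :=
  tendsto_natCast_div_add_atTop 1

lemma tendsto_const_div_depth (c : ℝ) :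
    Tendsto (fun L : ℕ => c / ((L : ℝ) + 1)) atTop (𝓝 0) := by
  have := (tendsto_const_div_atTop_nhds_zero_nat c).comp (tendsto_add_atTop_nat 1)
  refine this.congr fun L => ?_
  simp

lemma tendsto_rates {d C w : ℕ} (hw : min C d ≤ w)
    (A : Matrix (Fin C) (Fin d) ℝ) (F : ℕ → LinearNetwork d C w)
    (hF : ∀ L, 1 ≤ L → (F L).depth = L ∧ (F L).toMatrix = A ∧
      ∀ G : LinearNetwork d C w, G.depth = L → G.toMatrix = A →
        (F L).weightSq ≤ G.weightSq) :
    Tendsto (fun L : ℕ => (F L).weightSq / (L : ℝ)) atTop (𝓝 (A.rank : ℝ)) ∧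
      ∀ a : ℝ, 0 < a →
        Tendsto (fun L : ℕ => (F L).schattenRate a) atTop
          (𝓝 (((C : ℝ) + d) * (A.rank : ℝ))) ∧
        Tendsto (fun L : ℕ => (F L).factorRate a) atTop
          (𝓝 (((C : ℝ) + d) * (A.rank : ℝ))) := by
  have hmin : ∀ L, 1 ≤ L → (F L).weightSq / (L : ℝ) = schattenSum (2 / (L : ℝ)) A := by
    intro L hL
    obtain ⟨h1, h2, h3⟩ := hF L hL
    obtain ⟨G, g1, g2, g3⟩ := exists_network_weightSq_eq hw hL A
    have h4 := depth_mul_schattenSum_le_weightSq (F L)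
    have h5 := h3 G g1 g2
    rw [h1, h2] at h4
    have : (0 : ℝ) < L := by exact_mod_cast hL
    rw [div_eq_iff this.ne']
    linarith
  have hS := tendsto_schattenSum A
  refine ⟨hS.congr' ?_, fun a ha => ?_⟩
  · filter_upwards [eventually_ge_atTop 1] with L hL using (hmin L hL).symm
  have hSr : Tendsto (fun L : ℕ => schattenSum (2 / (L : ℝ)) A ^ ((L : ℝ) / (L + 1))) atTop
      (𝓝 (A.rank : ℝ)) := by
    have := hS.rpow tendsto_depth_ratio (Or.inr one_pos)
    simpa using this
  have har : Tendsto (fun L : ℕ => a ^ (2 / ((L : ℝ) + 1))) atTop (𝓝 1) := by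
    have := (Real.continuousAt_const_rpow (a := a) ha.ne').tendsto.comp
      (tendsto_const_div_depth 2)
    simpa [Function.comp_def] using this
  have hsch : ∀ L, 1 ≤ L → (F L).schattenRate a = a ^ (2 / ((L : ℝ) + 1)) *
      schattenSum (2 / (L : ℝ)) A ^ ((L : ℝ) / (L + 1)) *
      (min C d : ℝ) ^ (1 / ((L : ℝ) + 1)) * ((C : ℝ) + d) ^ ((L : ℝ) / (L + 1)) := by
    intro L hL
    obtain ⟨h1, h2, -⟩ := hF L hL
    rw [LinearNetwork.schattenRate_eq, LinearNetwork.index, h1, h2]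
  have hfac : ∀ L, 1 ≤ L → (F L).factorRate a = a ^ (2 / ((L : ℝ) + 1)) *
      schattenSum (2 / (L : ℝ)) A ^ ((L : ℝ) / (L + 1)) * ((C : ℝ) + d) := by
    intro L hL
    obtain ⟨h1, h2, -⟩ := hF L hL
    rw [LinearNetwork.factorRate_eq _ (F L).weightSq_nonneg, h1, hmin L hL]
  constructor
  · have hdr : Tendsto (fun L : ℕ => ((C : ℝ) + d) ^ ((L : ℝ) / (L + 1))) atTop
        (𝓝 ((C : ℝ) + d)) := by
      have := (tendsto_const_nhds (x := (C : ℝ) + d)).rpow tendsto_depth_ratio (Or.inr one_pos)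
      simpa using this
    obtain hm | hm := Nat.eq_zero_or_pos (min C d)
    · -- The factor `0 ^ (1 / (L + 1))` does not tend to one, but then the matrix vanishes.
      have hm' : (min C d : ℝ) = 0 := by exact_mod_cast hm
      have hr : A.rank = 0 := by have := rank_le_min A; omega
      rw [hr, Nat.cast_zero, mul_zero]
      refine tendsto_const_nhds.congr' ?_
      filter_upwards [eventually_ge_atTop 1] with L hL
      rw [hsch L hL, hm', Real.zero_rpow (by positivity)]
      simp
    · have hm' : (min C d : ℝ) ≠ 0 := by exact_mod_cast hm.ne'
      have hmr : Tendsto (fun L : ℕ => (min C d : ℝ) ^ (1 / ((L : ℝ) + 1))) atTop (𝓝 1) := by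
        have := (Real.continuousAt_const_rpow (a := (min C d : ℝ)) hm').tendsto.comp
          (tendsto_const_div_depth 1)
        simpa [Function.comp_def] using this
      have hlim := ((har.mul hSr).mul hmr).mul hdr
      rw [show (1 : ℝ) * (A.rank : ℝ) * 1 * ((C : ℝ) + d) = ((C : ℝ) + d) * A.rank by ring] at hlim
      refine hlim.congr' ?_
      filter_upwards [eventually_ge_atTop 1] with L hL using (hsch L hL).symm
  · have hlim := (har.mul hSr).mul (tendsto_const_nhds (x := (C : ℝ) + d))
    rw [show (1 : ℝ) * (A.rank : ℝ) * ((C : ℝ) + d) = ((C : ℝ) + d) * A.rank by ring] at hlim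
    refine hlim.congr' ?_
    filter_upwards [eventually_ge_atTop 1] with L hL using (hfac L hL).symm

/-! ### The standard Gaussian measure -/

section Gaussian

variable {V : Type*} [NormedAddCommGroup V] [InnerProductSpace ℝ V] [FiniteDimensional ℝ V]
  [MeasurableSpace V] [BorelSpace V]

/-- The density of the standard Gaussian measure; the normalization is written as an integral. -/
noncomputable def gaussDensity (g : V) : ℝ :=
  (∫ x : V, Real.exp (-(1 / 2) * ‖x‖ ^ 2))⁻¹ * Real.exp (-(1 / 2) * ‖g‖ ^ 2)

variable (V) in
/-- The standard Gaussian measure on a finite-dimensional inner product space, given by its density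
so that translations are immediate. -/
noncomputable def gauss : Measure V :=
  volume.withDensity fun g => ENNReal.ofReal (gaussDensity g)

variable (V) in
lemma integral_exp_neg_sq_pos {b : ℝ} (hb : 0 < b) : 0 < ∫ x : V, Real.exp (-b * ‖x‖ ^ 2) := by
  rw [GaussianFourier.integral_rexp_neg_mul_sq_norm hb]
  positivity

variable (V) in
lemma integrable_exp_neg_sq {b : ℝ} (hb : 0 < b) :
    Integrable fun x : V => Real.exp (-b * ‖x‖ ^ 2) := by
  by_contra h
  exact (integral_exp_neg_sq_pos V hb).ne' (integral_undef h)

lemma gaussDensity_nonneg (g : V) : 0 ≤ gaussDensity g := by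
  have := integral_exp_neg_sq_pos V (b := 1 / 2) (by norm_num)
  unfold gaussDensity
  positivity

lemma continuous_gaussDensity : Continuous (gaussDensity : V → ℝ) := by
  unfold gaussDensity
  fun_prop

lemma measurable_gaussDensity : Measurable (gaussDensity : V → ℝ) :=
  continuous_gaussDensity.measurable

lemma integral_gauss (f : V → ℝ) : ∫ g, f g ∂gauss V = ∫ g, gaussDensity g * f g := by
  rw [gauss, integral_withDensity_eq_integral_toReal_smul
    (measurable_gaussDensity.ennreal_ofReal) (by simp)]
  simp [ENNReal.toReal_ofReal (gaussDensity_nonneg _)]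

lemma integrable_gauss_iff (f : V → ℝ) :
    Integrable f (gauss V) ↔ Integrable fun g => gaussDensity g * f g := by
  rw [gauss, integrable_withDensity_iff_integrable_smul'
    (measurable_gaussDensity.ennreal_ofReal) (by simp)]
  simp [ENNReal.toReal_ofReal (gaussDensity_nonneg _)]

instance : IsProbabilityMeasure (gauss V) := by
  have h := integral_exp_neg_sq_pos V (b := 1 / 2) (by norm_num)
  constructor
  rw [gauss, withDensity_apply _ MeasurableSet.univ, Measure.restrict_univ,
    ← ofReal_integral_eq_lintegral_ofReal _ (Eventually.of_forall gaussDensity_nonneg)]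
  · unfold gaussDensity
    rw [integral_const_mul, inv_mul_cancel₀ h.ne', ENNReal.ofReal_one]
  · exact (integrable_exp_neg_sq V (by norm_num)).const_mul _

lemma gaussDensity_add (g b : V) :
    gaussDensity (g + b) = gaussDensity g * Real.exp (-inner ℝ b g - ‖b‖ ^ 2 / 2) := by
  unfold gaussDensity
  rw [mul_assoc, ← Real.exp_add, norm_add_sq_real, real_inner_comm]
  ring_nf

/-- The translation formula of Cameron and Martin. -/
lemma integral_gauss_shift (F : V → ℝ) (b : V) :
    ∫ g, F (g + b) * Real.exp (-inner ℝ b g - ‖b‖ ^ 2 / 2) ∂gauss V = ∫ g, F g ∂gauss V := by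
  rw [integral_gauss, integral_gauss,
    ← integral_add_right_eq_self (fun g => gaussDensity g * F g) b]
  congr 1 with g
  rw [gaussDensity_add]
  ring

lemma integrable_gauss_shift {F : V → ℝ} (hF : Integrable F (gauss V)) (b : V) :
    Integrable (fun g => F (g + b) * Real.exp (-inner ℝ b g - ‖b‖ ^ 2 / 2)) (gauss V) := by
  rw [integrable_gauss_iff] at hF ⊢
  refine (hF.comp_add_right b).congr (Eventually.of_forall fun g => ?_)
  simp only
  rw [gaussDensity_add]
  ring

lemma integral_gauss_neg (F : V → ℝ) : ∫ g, F (-g) ∂gauss V = ∫ g, F g ∂gauss V := by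
  rw [integral_gauss, integral_gauss, ← integral_neg_eq_self]
  simp [gaussDensity]

lemma integral_gauss_inner (b : V) : ∫ g, inner ℝ b g ∂gauss V = 0 := by
  have := integral_gauss_neg fun g : V => inner ℝ b g
  simp only [inner_neg_right, integral_neg] at this
  linarith

lemma integrable_gauss_exp_inner (b : V) :
    Integrable (fun g => Real.exp (inner ℝ b g)) (gauss V) := by
  have := (integrable_gauss_shift (integrable_const (1 : ℝ)) (-b)).mul_const
    (Real.exp (‖b‖ ^ 2 / 2))
  refine this.congr (Eventually.of_forall fun g => ?_)
  simp only [one_mul, ← Real.exp_add, inner_neg_left, norm_neg]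
  ring_nf

lemma integral_gauss_exp_inner (b : V) :
    ∫ g, Real.exp (inner ℝ b g) ∂gauss V = Real.exp (‖b‖ ^ 2 / 2) := by
  have h := integral_gauss_shift (fun _ : V => (1 : ℝ)) (-b)
  simp only [one_mul, inner_neg_left, norm_neg, neg_neg, Real.exp_sub, integral_const,
    probReal_univ, smul_eq_mul, integral_div] at h
  rwa [div_eq_iff (Real.exp_pos _).ne', one_mul] at h

lemma integrable_gauss_inner (b : V) : Integrable (fun g => inner ℝ b g) (gauss V) := by
  refine ((integrable_gauss_exp_inner b).add (integrable_gauss_exp_inner (-b))).mono'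
    (by fun_prop) (Eventually.of_forall fun g => ?_)
  simp only [Pi.add_apply, inner_neg_left, Real.norm_eq_abs]
  have h1 := Real.add_one_le_exp (inner ℝ b g)
  have h2 := Real.add_one_le_exp (-inner ℝ b g)
  have h3 := Real.exp_pos (inner ℝ b g)
  have h4 := Real.exp_pos (-inner ℝ b g)
  rw [abs_le]
  constructor <;> linarith

/-- The tangent line of the logarithm, used as a linearized Jensen inequality. -/
lemma le_log_add_exp_div {q : ℝ} (hq : 0 < q) (t : ℝ) : t ≤ Real.log q + Real.exp t / q - 1 := by
  have := Real.add_one_le_exp (t - Real.log q)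
  rw [Real.exp_sub, Real.exp_log hq] at this
  linarith

/-- The PAC-Bayes change of measure between two Gaussians with the same covariance: the quadratic
term is their relative entropy. -/
lemma integral_gauss_le_of_exp_le {ψ : V → ℝ} (hψ : Measurable ψ) {K : ℝ} (hK : ∀ u, |ψ u| ≤ K)
    {q a : ℝ} (ha : 0 < a) (hq : 0 < q) (M A : V)
    (h : ∫ g, Real.exp (ψ (M + a • g)) ∂gauss V ≤ q) :
    ∫ g, ψ (A + a • g) ∂gauss V ≤ ‖A - M‖ ^ 2 / (2 * a ^ 2) + Real.log q := by
  set b : V := a⁻¹ • (A - M) with hb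
  have hMb : ∀ g, M + a • (g + b) = A + a • g := fun g => by
    rw [hb, smul_add, smul_inv_smul₀ ha.ne']; abel
  have hbn : ‖b‖ ^ 2 = ‖A - M‖ ^ 2 / a ^ 2 := by
    rw [hb, norm_smul, norm_inv, Real.norm_of_nonneg ha.le]; ring
  have hint1 : Integrable (fun g => ψ (A + a • g)) (gauss V) :=
    Integrable.of_bound (by fun_prop : Measurable _).aestronglyMeasurable K
      (Eventually.of_forall fun g => hK _)
  have hint2 : Integrable (fun g => Real.exp (ψ (M + a • g))) (gauss V) :=
    Integrable.of_bound (by fun_prop : Measurable _).aestronglyMeasurable (Real.exp K)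
      (Eventually.of_forall fun g => by
      rw [Real.norm_eq_abs, Real.abs_exp]
      exact Real.exp_le_exp.2 ((le_abs_self _).trans (hK _)))
  have hsh := integral_gauss_shift (fun g => Real.exp (ψ (M + a • g))) b
  have hshi := integrable_gauss_shift hint2 b
  have hint3 : Integrable (fun g => ψ (A + a • g) - inner ℝ b g) (gauss V) :=
    hint1.sub (integrable_gauss_inner b)
  have hint4 : Integrable (fun g => Real.log q + Real.exp (ψ (M + a • (g + b))) *
      Real.exp (-inner ℝ b g - ‖b‖ ^ 2 / 2) / q) (gauss V) :=
    (integrable_const _).add (hshi.div_const q)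
  have key : ∫ g, (ψ (A + a • g) - inner ℝ b g - ‖b‖ ^ 2 / 2) ∂gauss V ≤
      ∫ g, (Real.log q + Real.exp (ψ (M + a • (g + b))) *
        Real.exp (-inner ℝ b g - ‖b‖ ^ 2 / 2) / q - 1) ∂gauss V := by
    refine integral_mono (hint3.sub (integrable_const _)) (hint4.sub (integrable_const _))
      fun g => ?_
    simp only
    rw [← Real.exp_add, hMb]
    refine (le_log_add_exp_div hq _).trans (le_of_eq ?_)
    ring_nf
  have e1 : ∫ g, (ψ (A + a • g) - inner ℝ b g - ‖b‖ ^ 2 / 2) ∂gauss V =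
      ∫ g, ψ (A + a • g) ∂gauss V - ‖b‖ ^ 2 / 2 := by
    rw [integral_sub hint3 (integrable_const _),
      integral_sub hint1 (integrable_gauss_inner b), integral_gauss_inner]
    simp
  have e2 : ∫ g, (Real.log q + Real.exp (ψ (M + a • (g + b))) *
        Real.exp (-inner ℝ b g - ‖b‖ ^ 2 / 2) / q - 1) ∂gauss V =
      Real.log q + (∫ g, Real.exp (ψ (M + a • g)) ∂gauss V) / q - 1 := by
    rw [integral_sub hint4 (integrable_const _),
      integral_add (integrable_const _) (hshi.div_const q), integral_div, hsh]
    simp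
  rw [e1, e2] at key
  have h1 : (∫ g, Real.exp (ψ (M + a • g)) ∂gauss V) / q ≤ 1 := (div_le_one hq).2 h
  rw [hbn] at key
  have e3 : ‖A - M‖ ^ 2 / (2 * a ^ 2) = ‖A - M‖ ^ 2 / a ^ 2 / 2 := by ring
  linarith

end Gaussian

/-! ### Exponential moments of the generalization gap -/

lemma integral_gauss_exp_sq : ∫ ξ : ℝ, Real.exp (ξ ^ 2 / 4) ∂gauss ℝ = √2 := by
  rw [integral_gauss]
  unfold gaussDensity
  simp_rw [mul_assoc, ← Real.exp_add]
  rw [integral_const_mul]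
  have h1 := GaussianFourier.integral_rexp_neg_mul_sq_norm (V := ℝ) (b := 1 / 2) (by norm_num)
  have h2 := GaussianFourier.integral_rexp_neg_mul_sq_norm (V := ℝ) (b := 1 / 4) (by norm_num)
  have e : ∀ ξ : ℝ, -(1 / 2) * ‖ξ‖ ^ 2 + ξ ^ 2 / 4 = -(1 / 4) * ‖ξ‖ ^ 2 := fun ξ => by
    rw [Real.norm_eq_abs, sq_abs]; ring
  simp_rw [e]
  rw [h1, h2, Module.finrank_self, Nat.cast_one, ← Real.sqrt_eq_rpow, ← Real.sqrt_eq_rpow,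
    ← Real.sqrt_inv, ← Real.sqrt_mul (by positivity)]
  congr 1
  field_simp
  norm_num

/-- A sub-Gaussian variable has a bounded square-exponential moment, by integrating its moment
generating function against a Gaussian. -/
lemma lintegral_exp_sq_le {Ω : Type*} [MeasurableSpace Ω] {μ : Measure Ω} [SFinite μ]
    {X : Ω → ℝ} (hX : Measurable X) {s : ℝ} (hs : 0 < s)
    (h : ∀ t : ℝ, ∫⁻ ω, ENNReal.ofReal (Real.exp (t * X ω)) ∂μ ≤
      ENNReal.ofReal (Real.exp (s * t ^ 2 / 2))) :
    ∫⁻ ω, ENNReal.ofReal (Real.exp (X ω ^ 2 / (4 * s))) ∂μ ≤ 2 := by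
  have h2s : √(2 * s) ^ 2 = 2 * s := Real.sq_sqrt (by positivity)
  have hpt : ∀ ω, ENNReal.ofReal (Real.exp (X ω ^ 2 / (4 * s))) =
      ∫⁻ ξ, ENNReal.ofReal (Real.exp (ξ / √(2 * s) * X ω)) ∂gauss ℝ := fun ω => by
    have e : (fun ξ : ℝ => Real.exp (ξ / √(2 * s) * X ω)) =
        fun ξ => Real.exp (inner ℝ (X ω / √(2 * s)) ξ) := by
      funext ξ
      simp only [RCLike.inner_apply, conj_trivial]
      simp
      ring
    rw [← ofReal_integral_eq_lintegral_ofReal _ (Eventually.of_forall fun _ => Real.exp_nonneg _)]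
    · rw [e, integral_gauss_exp_inner, Real.norm_eq_abs, sq_abs, div_pow, h2s]
      congr 2
      ring
    · rw [e]; exact integrable_gauss_exp_inner _
  simp_rw [hpt]
  rw [lintegral_lintegral_swap (by fun_prop)]
  calc ∫⁻ ξ, ∫⁻ ω, ENNReal.ofReal (Real.exp (ξ / √(2 * s) * X ω)) ∂μ ∂gauss ℝ
      ≤ ∫⁻ ξ, ENNReal.ofReal (Real.exp (ξ ^ 2 / 4)) ∂gauss ℝ := by
        refine lintegral_mono fun ξ => (h _).trans (le_of_eq ?_)
        rw [div_pow, h2s]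
        congr 2
        field_simp
        norm_num
    _ = ENNReal.ofReal √2 := by
        rw [← ofReal_integral_eq_lintegral_ofReal _
          (Eventually.of_forall fun _ => Real.exp_nonneg _), integral_gauss_exp_sq]
        by_contra hn
        have := integral_undef hn
        rw [integral_gauss_exp_sq] at this
        norm_num at this
    _ ≤ 2 := by
        rw [ENNReal.ofReal_le_iff_le_toReal (by simp), ENNReal.toReal_ofNat]
        exact Real.sqrt_le_iff.2 ⟨by norm_num, by norm_num⟩

section Gap

variable {Z : Type*} [MeasurableSpace Z] {N : ℕ}

/-- The expectation of `h` minus its average over the sample `S`. -/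
noncomputable def empGap (D : Measure Z) (S : Fin N → Z) (h : Z → ℝ) : ℝ :=
  (∫ z, h z ∂D) - (1 / (N : ℝ)) * ∑ i, h (S i)

lemma abs_empGap_le (hN : 0 < N) (D : Measure Z) [IsProbabilityMeasure D] (S : Fin N → Z)
    {h : Z → ℝ} {v : ℝ} (hv : ∀ z, |h z| ≤ v) : |empGap D S h| ≤ 2 * v := by
  have hN' : (0 : ℝ) < N := by exact_mod_cast hN
  have h1 : |∫ z, h z ∂D| ≤ v := by
    have := norm_integral_le_of_norm_le_const (μ := D) (f := h) (Eventually.of_forall hv)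
    simpa using this
  have h2 : |(1 / (N : ℝ)) * ∑ i, h (S i)| ≤ v := by
    rw [abs_mul, abs_of_pos (by positivity : 0 < 1 / (N : ℝ)), one_div_mul_eq_div,
      div_le_iff₀ hN']
    refine (Finset.abs_sum_le_sum_abs _ _).trans ((Finset.sum_le_sum fun i _ => hv (S i)).trans ?_)
    simp [mul_comm]
  have := abs_sub (∫ z, h z ∂D) ((1 / (N : ℝ)) * ∑ i, h (S i))
  unfold empGap
  linarith

/-- Hoeffding's lemma for the sample mean. -/
lemma lintegral_exp_empGap_le (hN : 0 < N) (D : Measure Z) [IsProbabilityMeasure D]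
    {h : Z → ℝ} (hm : Measurable h) {v : ℝ} (hv : ∀ z, |h z| ≤ v) (t : ℝ) :
    ∫⁻ S : Fin N → Z, ENNReal.ofReal (Real.exp (t * empGap D S h)) ∂Measure.pi (fun _ => D) ≤
      ENNReal.ofReal (Real.exp (v ^ 2 / N * t ^ 2 / 2)) := by
  have hN' : (0 : ℝ) < N := by exact_mod_cast hN
  set m := ∫ z, h z ∂D with hmdef
  have hsub := ProbabilityTheory.hasSubgaussianMGF_of_mem_Icc (μ := D) (X := h) (a := -v) (b := v)
    hm.aemeasurable (Eventually.of_forall fun z => abs_le.1 (hv z))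
  have hmgf := hsub.mgf_le (-(t / N))
  have hsum : ∀ S : Fin N → Z, Real.exp (t * empGap D S h) =
      ∏ i, Real.exp (-(t / N) * (h (S i) - m)) := fun S => by
    rw [← Real.exp_sum, ← Finset.mul_sum, Finset.sum_sub_distrib, empGap]
    congr 1
    simp only [Finset.sum_const, Finset.card_univ, Fintype.card_fin, nsmul_eq_mul]
    field_simp
    ring
  have hint : Integrable (fun z => Real.exp (-(t / N) * (h z - m))) D := hsub.integrable_exp_mul _
  have hprod : Integrable (fun S : Fin N → Z => ∏ i, Real.exp (-(t / N) * (h (S i) - m)))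
      (Measure.pi fun _ => D) :=
    Integrable.fintype_prod (f := fun _ z => Real.exp (-(t / N) * (h z - m))) fun _ => hint
  simp_rw [hsum]
  rw [← ofReal_integral_eq_lintegral_ofReal hprod (Eventually.of_forall fun S =>
    Finset.prod_nonneg fun _ _ => Real.exp_nonneg _)]
  refine ENNReal.ofReal_le_ofReal ?_
  rw [integral_fintype_prod_eq_prod (fun _ z => Real.exp (-(t / N) * (h z - m)))]
  simp only [Finset.prod_const, Finset.card_univ, Fintype.card_fin]
  have hle : ∫ z, Real.exp (-(t / N) * (h z - m)) ∂D ≤ Real.exp (v ^ 2 * (t / N) ^ 2 / 2) := by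
    refine le_trans hmgf (le_of_eq ?_)
    congr 1
    simp only [NNReal.coe_pow, NNReal.coe_div, coe_nnnorm, NNReal.coe_ofNat, Real.norm_eq_abs]
    rw [div_pow, sq_abs]
    ring
  calc (∫ z, Real.exp (-(t / N) * (h z - m)) ∂D) ^ N
      ≤ Real.exp (v ^ 2 * (t / N) ^ 2 / 2) ^ N :=
        pow_le_pow_left₀ (integral_nonneg fun _ => Real.exp_nonneg _) hle N
    _ = _ := by
        rw [← Real.exp_nat_mul]
        congr 1
        field_simp

lemma measurable_empGap (D : Measure Z) {h : Z → ℝ} (hm : Measurable h) :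
    Measurable fun S : Fin N → Z => empGap D S h := by
  unfold empGap
  fun_prop

lemma lintegral_exp_empGap_sq_le (hN : 0 < N) (D : Measure Z) [IsProbabilityMeasure D]
    {h : Z → ℝ} (hm : Measurable h) {v : ℝ} (hv0 : 0 < v) (hv : ∀ z, |h z| ≤ v) :
    ∫⁻ S : Fin N → Z, ENNReal.ofReal (Real.exp (empGap D S h ^ 2 / (4 * (v ^ 2 / N))))
      ∂Measure.pi (fun _ => D) ≤ 2 := by
  have hN' : (0 : ℝ) < N := by exact_mod_cast hN
  exact lintegral_exp_sq_le (measurable_empGap D hm) (by positivity)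
    (lintegral_exp_empGap_le hN D hm hv)

end Gap

/-! ### PAC-Bayes bounds holding simultaneously for countably many priors -/

section Gap

variable {U Z : Type*} [MeasurableSpace U] [MeasurableSpace Z] {N : ℕ}

lemma measurable_empGap_prod (D : Measure Z) [IsProbabilityMeasure D] {h : U → Z → ℝ}
    (hm : Measurable (Function.uncurry h)) :
    Measurable fun p : (Fin N → Z) × U => empGap D p.1 (h p.2) := by
  have h1 : Measurable fun u : U => ∫ z, h u z ∂D :=
    (hm.stronglyMeasurable.integral_prod_right).measurable
  have h2 : ∀ i, Measurable fun p : (Fin N → Z) × U => h p.2 (p.1 i) := fun i =>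
    hm.comp (measurable_snd.prodMk ((measurable_pi_apply i).comp measurable_fst))
  unfold empGap
  exact (h1.comp measurable_snd).sub ((Finset.measurable_sum _ fun i _ => h2 i).const_mul _)

lemma measurable_empGap_param (D : Measure Z) [IsProbabilityMeasure D] {h : U → Z → ℝ}
    (hm : Measurable (Function.uncurry h)) (S : Fin N → Z) :
    Measurable fun u => empGap D S (h u) :=
  (measurable_empGap_prod D hm).comp (measurable_const.prodMk measurable_id)

lemma integrable_of_abs_le (D : Measure Z) [IsProbabilityMeasure D] {f : U → Z → ℝ}
    (hf : Measurable (Function.uncurry f)) {E : ℝ} (hE : ∀ u z, |f u z| ≤ E) (u : U) :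
    Integrable (f u) D :=
  Integrable.of_bound (hf.comp measurable_prodMk_left).aestronglyMeasurable E
    (Eventually.of_forall fun _ => hE _ _)

end Gap

section Chaining

variable {V : Type*} [NormedAddCommGroup V] [InnerProductSpace ℝ V] [FiniteDimensional ℝ V]
  [MeasurableSpace V] [BorelSpace V] {Z : Type*} [MeasurableSpace Z] {N : ℕ}

lemma sq_integral_le_integral_sq {Ω : Type*} [MeasurableSpace Ω] {μ : Measure Ω}
    [IsProbabilityMeasure μ] {X : Ω → ℝ} (h1 : Integrable X μ)
    (h2 : Integrable (fun ω => X ω ^ 2) μ) : (∫ ω, X ω ∂μ) ^ 2 ≤ ∫ ω, X ω ^ 2 ∂μ := by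
  set m := ∫ ω, X ω ∂μ with hm
  have : ∫ ω, (2 * m * X ω - m ^ 2) ∂μ ≤ ∫ ω, X ω ^ 2 ∂μ :=
    integral_mono ((h1.const_mul _).sub (integrable_const _)) h2 fun ω => by
      nlinarith [sq_nonneg (X ω - m)]
  rw [integral_sub (h1.const_mul _) (integrable_const _), integral_const_mul, ← hm] at this
  simp only [integral_const, probReal_univ, smul_eq_mul, one_mul] at this
  nlinarith

/-- For countably many Gaussian priors, with weights of sum at most one, the averaged gap at every
posterior is controlled by the distance of its center from the center of the prior. -/
lemma measure_pacBayes_le (hN : 0 < N) (D : Measure Z) [IsProbabilityMeasure D] {I : Type*}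
    [Countable I] {h : I → V → Z → ℝ} (hm : ∀ i, Measurable (Function.uncurry (h i)))
    {v a w : I → ℝ} (M : I → V) (hv : ∀ i, 0 < v i) (hbd : ∀ i u z, |h i u z| ≤ v i)
    (ha : ∀ i, 0 < a i) (hw : ∀ i, 0 < w i) (hsum : ∑' i, ENNReal.ofReal (w i) ≤ 1)
    {δ : ℝ} (hδ : 0 < δ) :
    Measure.pi (fun _ : Fin N => D) {S | ¬ ∀ i (A : V),
      (∫ g, empGap D S (h i (A + a i • g)) ∂gauss V) ^ 2 ≤
        4 * (v i ^ 2 / N) * (‖A - M i‖ ^ 2 / (2 * a i ^ 2) + Real.log (2 / (δ * w i)))} ≤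
      ENNReal.ofReal δ := by
  have hN' : (0 : ℝ) < N := by exact_mod_cast hN
  let ψ : I → (Fin N → Z) → V → ℝ := fun i S u => empGap D S (h i u) ^ 2 / (4 * (v i ^ 2 / N))
  have hψm : ∀ i, Measurable fun p : (Fin N → Z) × V => ψ i p.1 p.2 := fun i =>
    ((measurable_empGap_prod D (hm i)).pow_const 2).div_const _
  have hψe : ∀ i, Measurable fun p : (Fin N → Z) × V =>
      ENNReal.ofReal (Real.exp (ψ i p.1 (M i + a i • p.2))) := fun i => by
    have : Measurable fun p : (Fin N → Z) × V => ψ i p.1 (M i + a i • p.2) :=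
      (hψm i).comp (measurable_fst.prodMk (by fun_prop : Measurable fun p : (Fin N → Z) × V =>
        M i + a i • p.2))
    fun_prop
  let W : (Fin N → Z) → ENNReal := fun S => ∑' i, ENNReal.ofReal (w i) *
    ∫⁻ g, ENNReal.ofReal (Real.exp (ψ i S (M i + a i • g))) ∂gauss V
  have hZm : ∀ i, Measurable fun S => ∫⁻ g, ENNReal.ofReal (Real.exp (ψ i S (M i + a i • g)))
      ∂gauss V := fun i => (hψe i).lintegral_prod_right
  have hWm : Measurable W := Measurable.tsum fun i => (hZm i).const_mul _
  have hWint : ∫⁻ S, W S ∂Measure.pi (fun _ : Fin N => D) ≤ 2 := by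
    rw [lintegral_tsum fun i => ((hZm i).const_mul _).aemeasurable]
    calc ∑' i, ∫⁻ S, ENNReal.ofReal (w i) * ∫⁻ g, ENNReal.ofReal
          (Real.exp (ψ i S (M i + a i • g))) ∂gauss V ∂Measure.pi (fun _ : Fin N => D)
        ≤ ∑' i, ENNReal.ofReal (w i) * 2 := by
          refine ENNReal.tsum_le_tsum fun i => ?_
          rw [lintegral_const_mul _ (hZm i)]
          gcongr
          rw [lintegral_lintegral_swap (hψe i).aemeasurable]
          calc _ ≤ ∫⁻ _ : V, 2 ∂gauss V := by
                refine lintegral_mono fun g => ?_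
                exact lintegral_exp_empGap_sq_le hN D ((hm i).comp measurable_prodMk_left) (hv i)
                  (hbd i _)
            _ = 2 := by simp
      _ = (∑' i, ENNReal.ofReal (w i)) * 2 := ENNReal.tsum_mul_right
      _ ≤ 1 * 2 := by gcongr
      _ = 2 := one_mul 2
  have hmarkov : Measure.pi (fun _ : Fin N => D) {S | ENNReal.ofReal (2 / δ) ≤ W S} ≤
      ENNReal.ofReal δ := by
    refine (meas_ge_le_lintegral_div hWm.aemeasurable (by simpa using hδ) (by simp)).trans ?_
    rw [ENNReal.ofReal_div_of_pos hδ, ENNReal.ofReal_ofNat]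
    refine (ENNReal.div_le_div_right hWint _).trans (le_of_eq ?_)
    rw [ENNReal.div_eq_inv_mul, ENNReal.inv_div (by simp) (by simp), ENNReal.div_mul_cancel]
    · simp
    · simp
  refine (measure_mono fun S hS => ?_).trans hmarkov
  by_contra hlt
  refine hS fun i A => ?_
  simp only [Set.mem_ofPred_eq, not_le] at hlt
  set X : V → ℝ := fun u => empGap D S (h i u) with hX
  have hXm : Measurable X := measurable_empGap_param D (hm i) S
  have hXb : ∀ u, |X u| ≤ 2 * v i := fun u => abs_empGap_le hN D S (hbd i u)
  have hc : 0 < 4 * (v i ^ 2 / N) := by have := hv i; positivity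
  have hψ' : ∀ u, ψ i S u = X u ^ 2 / (4 * (v i ^ 2 / N)) := fun u => rfl
  have hψb : ∀ u, |ψ i S u| ≤ (2 * v i) ^ 2 / (4 * (v i ^ 2 / N)) := fun u => by
    rw [hψ', abs_of_nonneg (by positivity)]
    exact div_le_div_of_nonneg_right (sq_le_sq' (abs_le.1 (hXb u)).1 (abs_le.1 (hXb u)).2) hc.le
  have hψSm : Measurable (ψ i S) := (hXm.pow_const 2).div_const _
  have hterm := (ENNReal.le_tsum i).trans_lt hlt
  have hexp : ∫ g, Real.exp (ψ i S (M i + a i • g)) ∂gauss V ≤ 2 / (δ * w i) := by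
    have hint : Integrable (fun g => Real.exp (ψ i S (M i + a i • g))) (gauss V) :=
      Integrable.of_bound (by fun_prop : Measurable _).aestronglyMeasurable
        (Real.exp ((2 * v i) ^ 2 / (4 * (v i ^ 2 / N)))) (Eventually.of_forall fun g => by
          rw [Real.norm_eq_abs, Real.abs_exp]
          exact Real.exp_le_exp.2 ((le_abs_self _).trans (hψb _)))
    rw [← ofReal_integral_eq_lintegral_ofReal hint (Eventually.of_forall fun _ =>
      Real.exp_nonneg _), ← ENNReal.ofReal_mul (hw i).le] at hterm
    have h2 := (ENNReal.ofReal_lt_ofReal_iff (by positivity)).1 hterm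
    have := hw i
    rw [le_div_iff₀ (by positivity)]
    rw [lt_div_iff₀ hδ] at h2
    linarith
  have hwi := hw i
  have key := integral_gauss_le_of_exp_le hψSm hψb (ha i) (by positivity) (M i) A hexp
  have hXi : Integrable (fun g => X (A + a i • g)) (gauss V) :=
    Integrable.of_bound (by fun_prop : Measurable _).aestronglyMeasurable (2 * v i)
      (Eventually.of_forall fun g => hXb _)
  have hX2i : Integrable (fun g => X (A + a i • g) ^ 2) (gauss V) :=
    Integrable.of_bound (by fun_prop : Measurable _).aestronglyMeasurable ((2 * v i) ^ 2)
      (Eventually.of_forall fun g => by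
        rw [Real.norm_eq_abs, abs_pow]
        exact pow_le_pow_left₀ (abs_nonneg _) (hXb _) 2)
  have hj := sq_integral_le_integral_sq hXi hX2i
  simp only [hψ', integral_div] at key
  rw [div_le_iff₀ hc] at key
  calc _ ≤ _ := hj
    _ ≤ _ := key
    _ = _ := mul_comm _ _

/-! ### Gaussian smoothing and chaining over its scales -/

/-- The average of `f` over a Gaussian neighbourhood of the parameter `u`, at scale `a`. -/
noncomputable def smooth (a : ℝ) (f : V → Z → ℝ) (u : V) (z : Z) : ℝ :=
  ∫ g, f (u + a • g) z ∂gauss V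

lemma measurable_smooth (a : ℝ) {f : V → Z → ℝ} (hf : Measurable (Function.uncurry f)) :
    Measurable (Function.uncurry (smooth a f)) := by
  have : Measurable fun p : (V × Z) × V => f (p.1.1 + a • p.2) p.1.2 :=
    hf.comp ((by fun_prop : Measurable fun p : (V × Z) × V => p.1.1 + a • p.2).prodMk
      (measurable_snd.comp measurable_fst))
  exact (this.stronglyMeasurable.integral_prod_right (ν := gauss V)).measurable

lemma abs_smooth_le {Y : Type*} (a : ℝ) {f : V → Y → ℝ} {E : ℝ} (hE : ∀ u z, |f u z| ≤ E)
    (u : V) (z : Y) :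
    |smooth a f u z| ≤ E := by
  have := norm_integral_le_of_norm_le_const (μ := gauss V) (f := fun g => f (u + a • g) z)
    (Eventually.of_forall fun g => hE _ _)
  simpa [smooth] using this

lemma integrable_smooth_aux (a : ℝ) {f : V → Z → ℝ} (hf : Measurable (Function.uncurry f)) {E : ℝ}
    (hE : ∀ u z, |f u z| ≤ E) (u : V) (z : Z) :
    Integrable (fun g => f (u + a • g) z) (gauss V) := by
  have h1 : Measurable fun u => f u z := hf.comp measurable_prodMk_right
  exact Integrable.of_bound (by fun_prop : Measurable _).aestronglyMeasurable E
    (Eventually.of_forall fun g => hE _ _)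

lemma smooth_comm (a b : ℝ) {f : V → Z → ℝ} (hf : Measurable (Function.uncurry f)) {E : ℝ}
    (hE : ∀ u z, |f u z| ≤ E) (u : V) (z : Z) :
    smooth a (smooth b f) u z = smooth b (smooth a f) u z := by
  unfold smooth
  rw [integral_integral_swap]
  · refine integral_congr_ae (Eventually.of_forall fun g => ?_)
    refine integral_congr_ae (Eventually.of_forall fun g' => ?_)
    simp only
    congr 1
    abel
  · have h1 : Measurable fun u => f u z := hf.comp measurable_prodMk_right
    exact Integrable.of_bound (h1.comp (by fun_prop : Measurable fun p : V × V =>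
      u + a • p.1 + b • p.2)).aestronglyMeasurable E (Eventually.of_forall fun g => hE _ _)

lemma empGap_sub (D : Measure Z) (S : Fin N → Z) {f g : Z → ℝ} (hf : Integrable f D)
    (hg : Integrable g D) :
    empGap D S (fun z => f z - g z) = empGap D S f - empGap D S g := by
  unfold empGap
  rw [integral_sub hf hg, Finset.sum_sub_distrib]
  ring

lemma empGap_smooth (D : Measure Z) [IsProbabilityMeasure D] (S : Fin N → Z) (a : ℝ)
    {f : V → Z → ℝ} (hf : Measurable (Function.uncurry f)) {E : ℝ}
    (hE : ∀ u z, |f u z| ≤ E) (u : V) :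
    empGap D S (smooth a f u) = ∫ g, empGap D S (f (u + a • g)) ∂gauss V := by
  have hm : Measurable fun p : V × Z => f (u + a • p.1) p.2 :=
    hf.comp ((by fun_prop : Measurable fun p : V × Z => u + a • p.1).prodMk measurable_snd)
  have h1 : Integrable (fun g => ∫ z, f (u + a • g) z ∂D) (gauss V) :=
    Integrable.of_bound (hm.stronglyMeasurable.integral_prod_right).aestronglyMeasurable E
      (Eventually.of_forall fun g => by
        have := norm_integral_le_of_norm_le_const (μ := D) (f := f (u + a • g))
          (Eventually.of_forall fun z => hE _ _)
        simpa using this)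
  have h2 : ∀ i, Integrable (fun g => f (u + a • g) (S i)) (gauss V) := fun i =>
    integrable_smooth_aux a hf hE u (S i)
  unfold empGap smooth
  rw [integral_sub h1 ((integrable_finsetSum _ fun i _ => h2 i).const_mul _),
    integral_const_mul, integral_finsetSum _ fun i _ => h2 i, integral_integral_swap]
  exact Integrable.of_bound (hm.comp measurable_swap).aestronglyMeasurable E
    (Eventually.of_forall fun g => hE _ _)

/-- A link of the chain. As smoothings commute, the difference of two of them is a difference of
two averages of `f - smooth _ f`, each controlled by a change of measure. -/
lemma empGap_smooth_sub (D : Measure Z) [IsProbabilityMeasure D] (S : Fin N → Z) (a b : ℝ)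
    {f : V → Z → ℝ} (hf : Measurable (Function.uncurry f)) {E : ℝ}
    (hE : ∀ u z, |f u z| ≤ E) (u : V) :
    empGap D S (smooth a f u) - empGap D S (smooth b f u) =
      (∫ g, empGap D S (fun z => f (u + a • g) z - smooth b f (u + a • g) z) ∂gauss V) -
      ∫ g, empGap D S (fun z => f (u + b • g) z - smooth a f (u + b • g) z) ∂gauss V := by
  have key : ∀ a b : ℝ,
      ∫ g, empGap D S (fun z => f (u + a • g) z - smooth b f (u + a • g) z) ∂gauss V =
        empGap D S (smooth a f u) - empGap D S (smooth a (smooth b f) u) := fun a b => by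
    have hs := measurable_smooth b hf
    have hsE := abs_smooth_le b hE
    have hm := hf.sub hs
    have hmE : ∀ u z, |f u z - smooth b f u z| ≤ E + E := fun u z =>
      (abs_sub _ _).trans (add_le_add (hE u z) (hsE u z))
    rw [← empGap_smooth (f := fun u z => f u z - smooth b f u z) D S a hm hmE u,
      ← empGap_sub D S (integrable_of_abs_le D (measurable_smooth a hf) (abs_smooth_le a hE) u)
        (integrable_of_abs_le D (measurable_smooth a hs) (abs_smooth_le a hsE) u)]
    congr 1
    funext z
    exact integral_sub (integrable_smooth_aux a hf hE u z) (integrable_smooth_aux a hs hsE u z)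
  rw [key a b, key b a]
  have : smooth a (smooth b f) u = smooth b (smooth a f) u :=
    funext fun z => smooth_comm a b hf hE u z
  rw [this]
  ring

lemma abs_le_of_sq_le {x v n c r l : ℝ} (hv : 0 ≤ v) (hn : 0 < n) (hc : 0 < c) (hr : 0 ≤ r)
    (hl : 0 ≤ l) (h : x ^ 2 ≤ 4 * (v ^ 2 / n) * (r ^ 2 / (2 * c ^ 2) + l)) :
    |x| ≤ 2 / √n * (v / c * r + v * √l) := by
  refine abs_le_of_sq_le_sq (h.trans ?_) (by positivity)
  have e1 : √n ^ 2 = n := Real.sq_sqrt hn.le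
  have e2 : √l ^ 2 = l := Real.sq_sqrt hl
  have : r ^ 2 / (2 * c ^ 2) + l ≤ (r / c + √l) ^ 2 := by
    have h1 : r ^ 2 / (2 * c ^ 2) ≤ (r / c) ^ 2 := by
      rw [div_pow]; gcongr; nlinarith [sq_nonneg c]
    have h2 : 0 ≤ r / c * √l := by positivity
    nlinarith
  calc 4 * (v ^ 2 / n) * (r ^ 2 / (2 * c ^ 2) + l) ≤ 4 * (v ^ 2 / n) * (r / c + √l) ^ 2 := by
        gcongr
    _ = (2 / √n * (v / c * r + v * √l)) ^ 2 := by
        rw [mul_pow, div_pow, e1]; ring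

lemma tsum_ofReal_mul_geometric_le {ι : Type*} {w : ι → ℝ} (hw : ∀ i, 0 < w i)
    (hsum : ∑' i, ENNReal.ofReal (w i) ≤ 1) :
    ∑' p : ι × ℕ, ENNReal.ofReal (w p.1 * (1 / 2) ^ (p.2 + 1)) ≤ 1 := by
  have hg : ∑' j : ℕ, ENNReal.ofReal ((1 / 2 : ℝ) ^ (j + 1)) = 1 := by
    have hs : Summable fun j : ℕ => (1 / 2 : ℝ) ^ (j + 1) :=
      (summable_nat_add_iff 1).2 summable_geometric_two
    rw [← ENNReal.ofReal_tsum_of_nonneg (fun _ => by positivity) hs]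
    have : ∑' j : ℕ, (1 / 2 : ℝ) ^ (j + 1) = 1 := by
      simp_rw [pow_succ]
      rw [tsum_mul_right, tsum_geometric_two]
      norm_num
    rw [this, ENNReal.ofReal_one]
  rw [ENNReal.tsum_prod']
  calc ∑' i, ∑' j : ℕ, ENNReal.ofReal (w i * (1 / 2) ^ (j + 1))
      = ∑' i, ENNReal.ofReal (w i) * ∑' j : ℕ, ENNReal.ofReal ((1 / 2 : ℝ) ^ (j + 1)) := by
        refine tsum_congr fun i => ?_
        rw [← ENNReal.tsum_mul_left]
        exact tsum_congr fun j => ENNReal.ofReal_mul (hw i).le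
    _ ≤ 1 := by simpa only [hg, mul_one] using hsum

lemma sum_range_succ_div_two_pow_le (J : ℕ) :
    ∑ j ∈ Finset.range J, ((j : ℝ) + 1) * (1 / 2) ^ j ≤ 4 := by
  have : ∀ J : ℕ, ∑ j ∈ Finset.range J, ((j : ℝ) + 1) * (1 / 2) ^ j =
      4 - (2 * J + 4) * (1 / 2) ^ J := fun J => by
    induction J with
    | zero => norm_num
    | succ J ih =>
      rw [Finset.sum_range_succ, ih, pow_succ]
      push_cast
      ring
  rw [this]
  have : (0 : ℝ) ≤ (2 * J + 4) * (1 / 2) ^ J := by positivity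
  linarith

/-- The links of the chain: with noise at scale `c j` and amplitude `κ * b j`. -/
lemma measure_links_le (hN : 0 < N) (D : Measure Z) [IsProbabilityMeasure D] {f : V → Z → ℝ}
    (hf : Measurable (Function.uncurry f)) {κ : ℝ} (hκ : 0 < κ)
    (hsm : ∀ a, 0 ≤ a → ∀ u z, |f u z - smooth a f u z| ≤ κ * a)
    {ι : Type*} [Countable ι] (M : ι → V) {w : ι → ℝ} (hw : ∀ i, 0 < w i)
    (hsum : ∑' i, ENNReal.ofReal (w i) ≤ 1) {b c : ℕ → ℝ} (hb : ∀ j, 0 < b j) (hc : ∀ j, 0 < c j)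
    {δ : ℝ} (hδ : 0 < δ) :
    Measure.pi (fun _ : Fin N => D) {S | ¬ ∀ i (j : ℕ) (A : V),
      (∫ g, empGap D S (fun z => f (A + c j • g) z - smooth (b j) f (A + c j • g) z)
        ∂gauss V) ^ 2 ≤
        4 * ((κ * b j) ^ 2 / N) * (‖A - M i‖ ^ 2 / (2 * c j ^ 2) +
          Real.log (2 / (δ * (w i * (1 / 2) ^ (j + 1)))))} ≤ ENNReal.ofReal δ := by
  refine (measure_mono fun S hS => ?_).trans (measure_pacBayes_le hN D (I := ι × ℕ)
    (h := fun p u z => f u z - smooth (b p.2) f u z)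
    (fun p => hf.sub (measurable_smooth (b p.2) hf)) (v := fun p => κ * b p.2)
    (a := fun p => c p.2) (w := fun p => w p.1 * (1 / 2) ^ (p.2 + 1)) (fun p => M p.1)
    (fun p => mul_pos hκ (hb p.2)) (fun p u z => hsm _ (hb p.2).le u z) (fun p => hc p.2)
    (fun p => by have := hw p.1; positivity) (tsum_ofReal_mul_geometric_le hw hsum) hδ)
  exact fun h => hS fun i j A => h (i, j) A

/-- The chained bound: uniformly over all parameters `A` and countably many centers `M i`, the gap
at `A` is controlled by the distance from `A` to the center and by the weight of the center. -/
lemma measure_chaining_le (hN : 0 < N) (D : Measure Z) [IsProbabilityMeasure D] {f : V → Z → ℝ}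
    (hf : Measurable (Function.uncurry f)) {E κ : ℝ} (hE0 : 0 < E) (hE : ∀ u z, |f u z| ≤ E)
    (hκ : 0 < κ) (hsm : ∀ a, 0 ≤ a → ∀ u z, |f u z - smooth a f u z| ≤ κ * a)
    {ι : Type*} [Countable ι] (M : ι → V) {w : ι → ℝ} (hw : ∀ i, 0 < w i) (hw1 : ∀ i, w i ≤ 1)
    (hsum : ∑' i, ENNReal.ofReal (w i) ≤ 1) {δ : ℝ} (hδ : 0 < δ) (hδ1 : δ < 1) :
    Measure.pi (fun _ : Fin N => D) {S | ¬ ∀ i (A : V),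
      |empGap D S (f A)| ≤ 2 / √N * ((4 * (Nat.clog 2 N : ℝ) + 1) * (κ * ‖A - M i‖) +
        10 * E * √(Real.log (12 / (δ * w i))))} ≤ ENNReal.ofReal δ := by
  have hN' : (0 : ℝ) < N := by exact_mod_cast hN
  -- The coarsest scale `E / κ` is the one at which smoothing moves `f` by at most its range.
  let a : ℕ → ℝ := fun j => E / κ * (1 / 2) ^ j
  have ha : ∀ j, 0 < a j := fun j => by positivity
  have hκa : ∀ j, κ * a j = E * (1 / 2) ^ j := fun j => by simp only [a]; field_simp
  have hasucc : ∀ j, a (j + 1) = a j / 2 := fun j => by simp only [a, pow_succ]; ring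
  have hδ3 : 0 < δ / 3 := by positivity
  have ev0 := measure_pacBayes_le hN D (h := fun _ : ι => f) (fun _ => hf) (v := fun _ => E)
    (a := fun _ => a 0) M (fun _ => hE0) (fun _ => hE) (fun _ => ha 0) hw hsum hδ3
  have ev1 := measure_links_le hN D hf hκ hsm M hw hsum ha (fun j => ha (j + 1)) hδ3
  have ev2 := measure_links_le hN D hf hκ hsm M hw hsum (fun j => ha (j + 1)) ha hδ3
  have hδs : ENNReal.ofReal δ = ENNReal.ofReal (δ / 3) + ENNReal.ofReal (δ / 3) +
      ENNReal.ofReal (δ / 3) := by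
    rw [← ENNReal.ofReal_add hδ3.le hδ3.le, ← ENNReal.ofReal_add (by positivity) hδ3.le]
    ring_nf
  rw [hδs]
  refine le_trans ?_ (add_le_add (add_le_add ev0 ev1) ev2)
  refine le_trans ?_ (add_le_add_left (measure_union_le _ _) _)
  refine le_trans (measure_mono fun S hS => ?_) (measure_union_le _ _)
  by_contra hcon
  simp only [Set.mem_union, Set.mem_ofPred_eq, not_or, not_not] at hcon
  obtain ⟨⟨h0, h1⟩, h2⟩ := hcon
  refine hS fun i A => ?_
  have hwi := hw i
  set r := ‖A - M i‖ with hr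
  set B := Real.log (12 / (δ * w i)) with hB
  have hr0 : 0 ≤ r := norm_nonneg _
  have hδw : δ * w i ≤ 1 := mul_le_one₀ hδ1.le hwi.le (hw1 i)
  have hB1 : 1 ≤ B := by
    rw [hB, Real.le_log_iff_exp_le (by positivity)]
    have : (12 : ℝ) ≤ 12 / (δ * w i) := by
      rw [le_div_iff₀ (by positivity)]; nlinarith
    have := Real.exp_one_lt_d9
    linarith
  have hsB : 1 ≤ √B := Real.one_le_sqrt.2 hB1
  have hlog2 : Real.log 2 ≤ 1 := by have := Real.log_two_lt_d9; linarith
  have hlog2' : 0 ≤ Real.log 2 := Real.log_nonneg (by norm_num)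
  have hl0 : Real.log (2 / (δ / 3 * w i)) = B - Real.log 2 := by
    rw [hB, ← Real.log_div (by positivity) (by norm_num)]
    congr 1
    field_simp
    norm_num
  have hlj : ∀ j : ℕ, Real.log (2 / (δ / 3 * (w i * (1 / 2) ^ (j + 1)))) =
      B + j * Real.log 2 := fun j => by
    rw [hB, ← Real.log_pow, ← Real.log_mul (by positivity) (by positivity)]
    congr 1
    rw [pow_succ, one_div_pow]
    field_simp
    norm_num
  have hsj : ∀ j : ℕ, √(B + j * Real.log 2) ≤ (j + 1) * √B := fun j => by
    rw [Real.sqrt_le_left (by positivity), mul_pow, Real.sq_sqrt (by linarith)]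
    have hj : (0 : ℝ) ≤ j := j.cast_nonneg
    have e1 : (j : ℝ) * Real.log 2 ≤ j * B := by gcongr; linarith
    have e2 : 0 ≤ (j : ℝ) * B := by positivity
    have e3 : 0 ≤ (j : ℝ) ^ 2 * B := by positivity
    nlinarith
  have b0 : |empGap D S (smooth (a 0) f A)| ≤ 2 / √N * (κ * r + E * √B) := by
    rw [empGap_smooth D S (a 0) hf hE]
    refine (abs_le_of_sq_le hE0.le hN' (ha 0) hr0 (by rw [hl0]; linarith) (h0 i A)).trans ?_
    have : E / a 0 = κ := by simp only [a]; field_simp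
    rw [this, hl0]
    gcongr
    linarith
  have blink : ∀ j, |empGap D S (smooth (a (j + 1)) f A) - empGap D S (smooth (a j) f A)| ≤
      2 / √N * (4 * (κ * r) + 2 * E * √B * ((j + 1) * (1 / 2) ^ j)) := fun j => by
    have hp : 0 ≤ B + j * Real.log 2 := by positivity
    have c1 := abs_le_of_sq_le (mul_pos hκ (ha j)).le hN' (ha (j + 1)) hr0
      (by rw [hlj]; exact hp) (h1 i j A)
    have c2 := abs_le_of_sq_le (mul_pos hκ (ha (j + 1))).le hN' (ha j) hr0
      (by rw [hlj]; exact hp) (h2 i j A)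
    rw [hlj] at c1 c2
    have r1 : κ * a j / a (j + 1) = 2 * κ := by
      rw [hasucc]; have := (ha j).ne'; field_simp
    have r2 : κ * a (j + 1) / a j ≤ 2 * κ := by
      rw [hasucc, show κ * (a j / 2) / a j = κ / 2 by have := (ha j).ne'; field_simp]; linarith
    have r3 : κ * a (j + 1) ≤ κ * a j := by rw [hasucc]; have := ha j; gcongr; linarith
    rw [r1] at c1
    have hsj' := hsj j
    have hka : 0 < κ * a j := mul_pos hκ (ha j)
    have d1 : κ * a j * √(B + j * Real.log 2) ≤ E * √B * ((j + 1) * (1 / 2) ^ j) := by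
      calc κ * a j * √(B + j * Real.log 2) ≤ κ * a j * ((j + 1) * √B) := by gcongr
        _ = _ := by rw [hκa]; ring
    have d2 : κ * a (j + 1) * √(B + j * Real.log 2) ≤ E * √B * ((j + 1) * (1 / 2) ^ j) :=
      le_trans (by gcongr) d1
    rw [empGap_smooth_sub D S _ _ hf hE]
    refine (abs_sub _ _).trans ((add_le_add c1 c2).trans ?_)
    rw [← mul_add]
    refine mul_le_mul_of_nonneg_left ?_ (by positivity)
    have : κ * a (j + 1) / a j * r ≤ 2 * κ * r := by gcongr
    linarith
  set J := Nat.clog 2 N with hJ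
  have bsum : |empGap D S (smooth (a J) f A) - empGap D S (smooth (a 0) f A)| ≤
      2 / √N * (J * (4 * (κ * r)) + 8 * E * √B) := by
    rw [← Finset.sum_range_sub fun j => empGap D S (smooth (a j) f A)]
    refine (Finset.abs_sum_le_sum_abs _ _).trans
      ((Finset.sum_le_sum fun j _ => blink j).trans ?_)
    rw [← Finset.mul_sum, Finset.sum_add_distrib, ← Finset.mul_sum, Finset.sum_const,
      Finset.card_range, nsmul_eq_mul]
    refine mul_le_mul_of_nonneg_left ?_ (by positivity)
    rw [← Finset.mul_sum]
    have := mul_le_mul_of_nonneg_left (sum_range_succ_div_two_pow_le J)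
      (by positivity : 0 ≤ 2 * E * √B)
    linarith
  have bfin : |empGap D S (f A) - empGap D S (smooth (a J) f A)| ≤ 2 / √N * (E * √B) := by
    rw [← empGap_sub D S (integrable_of_abs_le D hf hE A)
      (integrable_of_abs_le D (measurable_smooth _ hf) (abs_smooth_le _ hE) A)]
    refine (abs_empGap_le hN D S (hsm (a J) (ha J).le A)).trans ?_
    rw [hκa]
    have hpow : (N : ℝ) ≤ 2 ^ J := by exact_mod_cast Nat.le_pow_clog (by norm_num) N
    have hsN : √(N : ℝ) ≤ 2 ^ J := by
      refine (Real.sqrt_le_left (by positivity)).2 (hpow.trans ?_)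
      have : (1 : ℝ) ≤ 2 ^ J := one_le_pow₀ (by norm_num)
      nlinarith
    have hinv : (1 / 2 : ℝ) ^ J ≤ 1 / √N := by
      rw [one_div_pow]
      exact one_div_le_one_div_of_le (by positivity) hsN
    calc 2 * (E * (1 / 2) ^ J) ≤ 2 * (E * (1 / √N)) := by gcongr
      _ = 2 / √N * (E * 1) := by ring
      _ ≤ _ := by gcongr
  have tri : |empGap D S (f A)| ≤ |empGap D S (smooth (a 0) f A)| +
      |empGap D S (smooth (a J) f A) - empGap D S (smooth (a 0) f A)| +
      |empGap D S (f A) - empGap D S (smooth (a J) f A)| := by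
    have e : empGap D S (f A) = empGap D S (smooth (a 0) f A) +
      (empGap D S (smooth (a J) f A) - empGap D S (smooth (a 0) f A)) +
      (empGap D S (f A) - empGap D S (smooth (a J) f A)) := by ring
    calc |empGap D S (f A)| = _ := congrArg _ e
      _ ≤ _ := abs_add_three _ _ _
  refine tri.trans ((add_le_add (add_le_add b0 bsum) bfin).trans (le_of_eq ?_))
  ring

end Chaining

/-! ### Matrices as Gaussian parameters -/

/-- Matrices as Euclidean vectors, so that the Frobenius norm is the norm. -/
abbrev MatVec (C d : ℕ) : Type := EuclideanSpace ℝ (Fin C × Fin d)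

/-- The vector of the entries of a matrix. -/
noncomputable def vecOf {C d : ℕ} (A : Matrix (Fin C) (Fin d) ℝ) : MatVec C d :=
  WithLp.toLp 2 fun p => A p.1 p.2

/-- The matrix with a given vector of entries. -/
def matOf {C d : ℕ} (u : MatVec C d) : Matrix (Fin C) (Fin d) ℝ := Matrix.of fun i j => u (i, j)

@[simp] lemma matOf_vecOf {C d : ℕ} (A : Matrix (Fin C) (Fin d) ℝ) : matOf (vecOf A) = A := rfl

lemma norm_vecOf_sq {C d : ℕ} (A : Matrix (Fin C) (Fin d) ℝ) : ‖vecOf A‖ ^ 2 = frobSq A := by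
  simp [EuclideanSpace.norm_sq_eq, vecOf, frobSq, Fintype.sum_prod_type]

lemma vecOf_sub {C d : ℕ} (A B : Matrix (Fin C) (Fin d) ℝ) : vecOf (A - B) = vecOf A - vecOf B :=
  rfl

lemma vecOf_zero {C d : ℕ} : vecOf (0 : Matrix (Fin C) (Fin d) ℝ) = 0 := rfl

lemma matOf_add_smul {C d : ℕ} (u g : MatVec C d) (a : ℝ) :
    matOf (u + a • g) = matOf u + a • matOf g := rfl

lemma continuous_matOf_mulVec {C d : ℕ} :
    Continuous fun p : MatVec C d × EuclideanSpace ℝ (Fin d) => matOf p.1 *ᵥ p.2.ofLp := by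
  unfold matOf
  refine continuous_pi fun i => ?_
  simp only [Matrix.mulVec, dotProduct, Matrix.of_apply]
  fun_prop

/-- The vector representing `u ↦ (u x)ᵢ`. -/
noncomputable def rowFunctional {C d : ℕ} (i : Fin C) (x : EuclideanSpace ℝ (Fin d)) : MatVec C d :=
  WithLp.toLp 2 fun p => if p.1 = i then x p.2 else 0

lemma inner_rowFunctional {C d : ℕ} (i : Fin C) (x : EuclideanSpace ℝ (Fin d)) (u : MatVec C d) :
    inner ℝ (rowFunctional i x) u = (matOf u *ᵥ x.ofLp) i := by
  simp only [rowFunctional, PiLp.inner_apply, RCLike.inner_apply, conj_trivial, matOf,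
    Matrix.mulVec, dotProduct, Matrix.of_apply, Fintype.sum_prod_type]
  rw [Finset.sum_eq_single i (fun b _ hb => by simp [hb]) (by simp)]
  simp

lemma norm_rowFunctional_sq {C d : ℕ} (i : Fin C) (x : EuclideanSpace ℝ (Fin d)) :
    ‖rowFunctional i x‖ ^ 2 = ‖x‖ ^ 2 := by
  simp only [EuclideanSpace.norm_sq_eq, rowFunctional, Fintype.sum_prod_type]
  rw [Finset.sum_eq_single i (fun b _ hb => by simp [hb]) (by simp)]
  simp

lemma exp_norm_le {C : ℕ} (t : Fin C → ℝ) :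
    Real.exp ‖t‖ ≤ 1 + ∑ i, (Real.exp (t i) + Real.exp (-t i)) := by
  have hs : 0 ≤ ∑ i, (Real.exp (t i) + Real.exp (-t i)) :=
    Finset.sum_nonneg fun _ _ => by positivity
  rcases isEmpty_or_nonempty (Fin C) with h | h
  · rw [Subsingleton.elim t 0]
    simp
  · obtain ⟨i, hi⟩ : ∃ i, ‖t‖ = ‖t i‖ := by
      obtain ⟨i, hi⟩ := Finite.exists_max fun i => ‖t i‖
      exact ⟨i, le_antisymm ((pi_norm_le_iff_of_nonneg (norm_nonneg _)).2 hi) (norm_le_pi_norm t i)⟩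
    have h1 := Finset.single_le_sum (f := fun i => Real.exp (t i) + Real.exp (-t i))
      (fun _ _ => by positivity) (Finset.mem_univ i)
    have h2 : Real.exp ‖t i‖ ≤ Real.exp (t i) + Real.exp (-t i) := by
      rw [Real.norm_eq_abs]
      rcases abs_choice (t i) with h | h <;> rw [h] <;>
        linarith [Real.exp_pos (t i), Real.exp_pos (-t i)]
    rw [hi]
    linarith

/-- For a fixed input, a Gaussian matrix has a logarithmic maximal output: this is why smoothing is
cheap in the maximum norm although no uniform bound over the inputs is available. -/
lemma exists_integrable_bound_mulVec {C d : ℕ} {y : EuclideanSpace ℝ (Fin d)} (hy : ‖y‖ ≤ 1) :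
    ∃ G : MatVec C d → ℝ, Integrable G (gauss (MatVec C d)) ∧
      (∀ g, ‖matOf g *ᵥ y.ofLp‖ ≤ G g) ∧
      ∫ g, G g ∂gauss (MatVec C d) ≤ Real.log (2 * C + 2) + 1 := by
  have hq : (0 : ℝ) < 2 * C + 2 := by positivity
  let G : MatVec C d → ℝ := fun g => Real.log (2 * C + 2) +
    (1 + ∑ i, (Real.exp (inner ℝ (rowFunctional i y) g) +
      Real.exp (inner ℝ (-rowFunctional i y) g))) / (2 * C + 2) - 1
  have hi : ∀ i : Fin C, Integrable (fun g => Real.exp (inner ℝ (rowFunctional i y) g) +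
      Real.exp (inner ℝ (-rowFunctional i y) g)) (gauss (MatVec C d)) := fun i =>
    (integrable_gauss_exp_inner _).add (integrable_gauss_exp_inner _)
  have hsum : Integrable (fun g => 1 + ∑ i, (Real.exp (inner ℝ (rowFunctional i y) g) +
      Real.exp (inner ℝ (-rowFunctional i y) g))) (gauss (MatVec C d)) :=
    (integrable_const _).add (integrable_finsetSum _ fun i _ => hi i)
  have hint : Integrable (fun g => Real.log (2 * C + 2) +
    (1 + ∑ i, (Real.exp (inner ℝ (rowFunctional i y) g) +
      Real.exp (inner ℝ (-rowFunctional i y) g))) / (2 * C + 2)) (gauss (MatVec C d)) :=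
    (integrable_const _).add (hsum.div_const _)
  refine ⟨G, hint.sub (integrable_const _), fun g => ?_, ?_⟩
  · refine (le_log_add_exp_div hq _).trans ?_
    simp only [G]
    gcongr
    refine (exp_norm_le _).trans (le_of_eq ?_)
    simp only [inner_neg_left, inner_rowFunctional]
  · have hexp : ∀ i : Fin C, ∫ g, (Real.exp (inner ℝ (rowFunctional i y) g) +
        Real.exp (inner ℝ (-rowFunctional i y) g)) ∂gauss (MatVec C d) ≤ 4 := fun i => by
      rw [integral_add (integrable_gauss_exp_inner _) (integrable_gauss_exp_inner _),
        integral_gauss_exp_inner, integral_gauss_exp_inner, norm_neg, norm_rowFunctional_sq]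
      have h1 : Real.exp (‖y‖ ^ 2 / 2) ≤ Real.exp (1 / 2) := by
        refine Real.exp_le_exp.2 ?_
        have := norm_nonneg y
        nlinarith
      have h2 : Real.exp (1 / 2) ≤ 2 := by
        have h3 : Real.exp (1 / 2) ^ 2 = Real.exp 1 := by
          rw [← Real.exp_nat_mul]; norm_num
        have := Real.exp_one_lt_d9
        nlinarith [Real.exp_pos (1 / 2)]
      linarith
    have hval : ∫ g, G g ∂gauss (MatVec C d) = Real.log (2 * C + 2) +
        (1 + ∑ i : Fin C, ∫ g, (Real.exp (inner ℝ (rowFunctional i y) g) +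
        Real.exp (inner ℝ (-rowFunctional i y) g)) ∂gauss (MatVec C d)) / (2 * C + 2) - 1 := by
      simp only [G]
      rw [integral_sub hint (integrable_const _), integral_add (integrable_const _)
        (hsum.div_const _), integral_div, integral_add (integrable_const _)
        (integrable_finsetSum _ fun i _ => hi i), integral_finsetSum _ fun i _ => hi i]
      simp
    rw [hval]
    have h4 : ∑ i : Fin C, ∫ g, (Real.exp (inner ℝ (rowFunctional i y) g) +
        Real.exp (inner ℝ (-rowFunctional i y) g)) ∂gauss (MatVec C d) ≤ C * 4 := by
      refine (Finset.sum_le_sum fun i _ => hexp i).trans ?_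
      simp
    have h5 : (1 + ∑ i : Fin C, ∫ g, (Real.exp (inner ℝ (rowFunctional i y) g) +
        Real.exp (inner ℝ (-rowFunctional i y) g)) ∂gauss (MatVec C d)) / (2 * C + 2) ≤ 2 := by
      rw [div_le_iff₀ hq]; linarith
    linarith

section TruncatedLoss

variable {d C : ℕ} {Y : Type*}

/-- The loss of the linear map with matrix `u`, set to zero on inputs of norm larger than `R`. -/
noncomputable def truncLoss (loss : (Fin C → ℝ) → Y → ℝ) (R : ℝ) (u : MatVec C d)
    (z : EuclideanSpace ℝ (Fin d) × Y) : ℝ :=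
  if ‖z.1‖ ≤ R then loss (matOf u *ᵥ z.1.ofLp) z.2 else 0

lemma measurable_truncLoss [MeasurableSpace Y] {loss : (Fin C → ℝ) → Y → ℝ}
    (hl : Measurable (Function.uncurry loss)) (R : ℝ) :
    Measurable (Function.uncurry (truncLoss (d := d) loss R)) := by
  have h1 : Measurable fun p : MatVec C d × (EuclideanSpace ℝ (Fin d) × Y) =>
      loss (matOf p.1 *ᵥ p.2.1.ofLp) p.2.2 :=
    hl.comp ((continuous_matOf_mulVec.measurable.comp
      (measurable_fst.prodMk (measurable_fst.comp measurable_snd))).prodMk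
      (measurable_snd.comp measurable_snd))
  refine Measurable.ite ?_ h1 measurable_const
  exact measurableSet_le (by fun_prop) measurable_const

lemma abs_truncLoss_le {loss : (Fin C → ℝ) → Y → ℝ} {E : ℝ} (hE0 : 0 ≤ E)
    (hE : ∀ z y, 0 ≤ loss z y ∧ loss z y ≤ E) (R : ℝ) (u : MatVec C d)
    (z : EuclideanSpace ℝ (Fin d) × Y) : |truncLoss loss R u z| ≤ E := by
  unfold truncLoss
  split_ifs
  · rw [abs_of_nonneg (hE _ _).1]; exact (hE _ _).2
  · simpa using hE0

/-- Smoothing at scale `a` moves the truncated loss by at most `a` times its Lipschitz constant in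
the matrix, up to a logarithm of the output dimension. -/
lemma abs_truncLoss_sub_smooth_le [MeasurableSpace Y] {loss : (Fin C → ℝ) → Y → ℝ}
    (hl : Measurable (Function.uncurry loss)) {E lam R : ℝ} (hE0 : 0 ≤ E) (hR : 0 ≤ R)
    (hlam : 0 ≤ lam)
    (hE : ∀ z y, 0 ≤ loss z y ∧ loss z y ≤ E)
    (hlip : ∀ z z' y, |loss z y - loss z' y| ≤ lam * ‖z - z'‖) {a : ℝ} (ha : 0 ≤ a)
    (u : MatVec C d) (z : EuclideanSpace ℝ (Fin d) × Y) :
    |truncLoss loss R u z - smooth a (truncLoss loss R) u z| ≤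
      lam * R * (Real.log (2 * C + 2) + 1) * a := by
  have hfi := integrable_smooth_aux a (measurable_truncLoss (d := d) hl R)
    (abs_truncLoss_le hE0 hE R) u z
  have hK : 0 ≤ Real.log (2 * C + 2) + 1 := by
    have : 0 ≤ Real.log (2 * C + 2) := Real.log_nonneg (by
      have : (0 : ℝ) ≤ C := C.cast_nonneg
      linarith)
    linarith
  by_cases hz : ‖z.1‖ ≤ R
  · set y : EuclideanSpace ℝ (Fin d) := ‖z.1‖⁻¹ • z.1 with hy
    have hyz : z.1 = ‖z.1‖ • y := by
      rcases eq_or_ne z.1 0 with h | h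
      · simp [h]
      · rw [hy, smul_inv_smul₀ (norm_ne_zero_iff.2 h)]
    have hy1 : ‖y‖ ≤ 1 := by
      rw [hy, norm_smul, norm_inv, norm_norm]
      exact inv_mul_le_one
    obtain ⟨G, hGi, hGb, hGK⟩ := exists_integrable_bound_mulVec (C := C) hy1
    have e : truncLoss loss R u z - smooth a (truncLoss loss R) u z =
        ∫ g, (truncLoss loss R u z - truncLoss loss R (u + a • g) z) ∂gauss (MatVec C d) := by
      rw [integral_sub (integrable_const _) hfi]
      simp [smooth]
    have hpt : ∀ g : MatVec C d, ‖truncLoss loss R u z - truncLoss loss R (u + a • g) z‖ ≤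
        lam * R * a * G g := fun g => by
      simp only [truncLoss, if_pos hz, Real.norm_eq_abs]
      refine (hlip _ _ _).trans ?_
      have hz' : z.1.ofLp = ‖z.1‖ • y.ofLp := congrArg WithLp.ofLp hyz
      have h1 : matOf u *ᵥ z.1.ofLp - matOf (u + a • g) *ᵥ z.1.ofLp =
          -((a * ‖z.1‖) • (matOf g *ᵥ y.ofLp)) := by
        rw [matOf_add_smul, Matrix.add_mulVec, Matrix.smul_mulVec, sub_add_cancel_left]
        nth_rewrite 1 [hz']
        rw [Matrix.mulVec_smul, smul_smul]
      rw [h1, norm_neg, norm_smul, Real.norm_of_nonneg (by positivity)]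
      have hG0 : 0 ≤ G g := (norm_nonneg _).trans (hGb g)
      calc lam * (a * ‖z.1‖ * ‖matOf g *ᵥ y.ofLp‖) ≤ lam * (a * R * G g) := by
            exact mul_le_mul_of_nonneg_left (mul_le_mul (by gcongr) (hGb g) (norm_nonneg _)
              (by positivity)) hlam
        _ = _ := by ring
    rw [e, ← Real.norm_eq_abs]
    refine (norm_integral_le_of_norm_le (hGi.const_mul _) (Eventually.of_forall hpt)).trans ?_
    rw [integral_const_mul]
    calc lam * R * a * ∫ g, G g ∂gauss (MatVec C d) ≤
          lam * R * a * (Real.log (2 * C + 2) + 1) := by gcongr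
      _ = _ := by ring
  · have h0 : ∀ v : MatVec C d, truncLoss loss R v z = 0 := fun v => if_neg hz
    simp only [smooth, h0, integral_zero, sub_zero, abs_zero]
    positivity

end TruncatedLoss

/-! ### Quantiles and truncation of the inputs -/

/-- A quantile of level `q`: the tail beyond `R` has mass at most `q`, and at least `q` if `R` is
included. -/
lemma exists_quantile {X : Type*} [MeasurableSpace X] (D : Measure X) [IsProbabilityMeasure D]
    {φ : X → ℝ} (hφ : Measurable φ) (h0 : ∀ x, 0 ≤ φ x) {q : ℝ} (hq0 : 0 < q) (hq1 : q ≤ 1) :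
    ∃ R, 0 ≤ R ∧ q ≤ D.real {x | R ≤ φ x} ∧ D.real {x | R < φ x} ≤ q := by
  have hms : ∀ r, MeasurableSet {x | r ≤ φ x} := fun r => measurableSet_le measurable_const hφ
  set Q : Set ℝ := {r | q ≤ D.real {x | r ≤ φ x}} with hQ
  have h0Q : (0 : ℝ) ∈ Q := by simpa [hQ, h0] using hq1
  have hanti : ∀ {r s : ℝ}, r ≤ s → D.real {x | s ≤ φ x} ≤ D.real {x | r ≤ φ x} := fun hrs =>
    measureReal_mono fun x hx => hrs.trans hx
  have hbdd : BddAbove Q := by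
    have hlim : Tendsto (fun n : ℕ => D.real {x | (n : ℝ) ≤ φ x}) atTop (𝓝 0) := by
      have h1 := tendsto_measure_iInter_atTop (μ := D) (s := fun n : ℕ => {x | (n : ℝ) ≤ φ x})
        (fun n => (hms n).nullMeasurableSet) (fun m n hmn x hx => by
          have : (m : ℝ) ≤ n := by exact_mod_cast hmn
          exact this.trans hx) ⟨0, measure_ne_top _ _⟩
      have h2 : ⋂ n : ℕ, {x | (n : ℝ) ≤ φ x} = ∅ := by
        ext x
        simp only [Set.mem_iInter, Set.mem_ofPred_eq, Set.mem_empty_iff_false, iff_false,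
          not_forall, not_le]
        exact exists_nat_gt _
      rw [h2, measure_empty] at h1
      exact (ENNReal.tendsto_toReal ENNReal.zero_ne_top).comp h1
    obtain ⟨n, hn⟩ := (hlim.eventually_lt_const hq0).exists
    refine ⟨n, fun r hr => ?_⟩
    by_contra hlt
    exact absurd (hr.trans (hanti (not_le.1 hlt).le)) (not_le.2 hn)
  have hinv : Tendsto (fun n : ℕ => 1 / ((n : ℝ) + 1)) atTop (𝓝 0) :=
    tendsto_one_div_add_atTop_nhds_zero_nat
  have hpos : ∀ n : ℕ, 0 < 1 / ((n : ℝ) + 1) := fun n => by positivity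
  have hdec : ∀ {m n : ℕ}, m ≤ n → 1 / ((n : ℝ) + 1) ≤ 1 / ((m : ℝ) + 1) := fun h =>
    Nat.one_div_le_one_div h
  set R := sSup Q with hR
  refine ⟨R, le_csSup hbdd h0Q, ?_, ?_⟩
  · have h1 := tendsto_measure_iInter_atTop (μ := D)
      (s := fun n : ℕ => {x | R - 1 / ((n : ℝ) + 1) ≤ φ x})
      (fun n => (hms _).nullMeasurableSet) (fun m n hmn x hx => by
        have := hdec hmn
        simp only [Set.mem_ofPred_eq] at hx ⊢
        linarith) ⟨0, measure_ne_top _ _⟩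
    have h2 : ⋂ n : ℕ, {x | R - 1 / ((n : ℝ) + 1) ≤ φ x} = {x | R ≤ φ x} := by
      ext x
      simp only [Set.mem_iInter, Set.mem_ofPred_eq]
      constructor
      · intro h
        have := le_of_tendsto' (tendsto_const_nhds.sub hinv) h
        simpa using this
      · intro h n
        linarith [hpos n]
    rw [h2] at h1
    have h3 := (ENNReal.tendsto_toReal (measure_ne_top D {x | R ≤ φ x})).comp h1
    refine ge_of_tendsto' h3 fun n => ?_
    obtain ⟨r, hr, hlt⟩ := exists_lt_of_lt_csSup ⟨0, h0Q⟩
      (show R - 1 / ((n : ℝ) + 1) < sSup Q by linarith [hpos n])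
    exact hr.trans (hanti hlt.le)
  · have h1 := tendsto_measure_iUnion_atTop (μ := D)
      (s := fun n : ℕ => {x | R + 1 / ((n : ℝ) + 1) ≤ φ x}) (fun m n hmn x hx => by
        have := hdec hmn
        simp only [Set.mem_ofPred_eq] at hx ⊢
        linarith)
    have h2 : ⋃ n : ℕ, {x | R + 1 / ((n : ℝ) + 1) ≤ φ x} = {x | R < φ x} := by
      ext x
      simp only [Set.mem_iUnion, Set.mem_ofPred_eq]
      constructor
      · rintro ⟨n, h⟩
        linarith [hpos n]
      · intro h
        obtain ⟨n, hn⟩ := exists_nat_one_div_lt (sub_pos.2 h)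
        exact ⟨n, by linarith⟩
    rw [h2] at h1
    have h3 := (ENNReal.tendsto_toReal (measure_ne_top D {x | R < φ x})).comp h1
    refine le_of_tendsto' h3 fun n => ?_
    by_contra hlt
    have := le_csSup hbdd (show R + 1 / ((n : ℝ) + 1) ∈ Q from (not_le.1 hlt).le)
    linarith [hpos n]

section Truncation

variable {d C N : ℕ} {Y : Type*}

lemma norm_le_sampleRadius (S : Fin N → EuclideanSpace ℝ (Fin d) × Y) (i : Fin N) :
    ‖(S i).1‖ ≤ sampleRadius S :=
  le_ciSup (f := fun i => ‖(S i).1‖) (Set.finite_range _).bddAbove i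

lemma sampleRadius_nonneg (S : Fin N → EuclideanSpace ℝ (Fin d) × Y) : 0 ≤ sampleRadius S :=
  Real.iSup_nonneg fun _ => norm_nonneg _

variable [MeasurableSpace Y]

/-- The sample contains a point beyond a quantile of level `log(2/δ)/N`, except with probability
`δ/2`. -/
lemma measure_sampleRadius_lt_le (hN : 0 < N) (D : Measure (EuclideanSpace ℝ (Fin d) × Y))
    [IsProbabilityMeasure D] {R δ : ℝ} (hδ : 0 < δ)
    (hR : Real.log (2 / δ) / N ≤ D.real {z | R ≤ ‖z.1‖}) :
    Measure.pi (fun _ : Fin N => D) {S | sampleRadius S < R} ≤ ENNReal.ofReal (δ / 2) := by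
  have hN' : (0 : ℝ) < N := by exact_mod_cast hN
  set q := Real.log (2 / δ) / N with hq
  have hms : MeasurableSet {z : EuclideanSpace ℝ (Fin d) × Y | R ≤ ‖z.1‖} :=
    measurableSet_le measurable_const (by fun_prop)
  have hsub : {S : Fin N → EuclideanSpace ℝ (Fin d) × Y | sampleRadius S < R} ⊆
      Set.pi Set.univ fun _ => {z | R ≤ ‖z.1‖}ᶜ := fun S hS i _ => by
    simpa using (norm_le_sampleRadius S i).trans_lt hS
  refine (measure_mono hsub).trans ?_
  rw [Measure.pi_pi]
  simp only [Finset.prod_const, Finset.card_univ, Fintype.card_fin]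
  have h1 : D {z | R ≤ ‖z.1‖}ᶜ ≤ ENNReal.ofReal (Real.exp (-q)) := by
    rw [← ofReal_measureReal, probReal_compl_eq_one_sub hms]
    refine ENNReal.ofReal_le_ofReal ?_
    have := Real.add_one_le_exp (-q)
    linarith
  calc _ ≤ ENNReal.ofReal (Real.exp (-q)) ^ N := by gcongr
    _ = ENNReal.ofReal (δ / 2) := by
      rw [← ENNReal.ofReal_pow (Real.exp_nonneg _), ← Real.exp_nat_mul, hq, mul_neg,
        mul_div_cancel₀ _ hN'.ne', Real.exp_neg, Real.exp_log (by positivity), inv_div]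

/-- Truncating the loss costs only the mass of the tail: the loss is nonnegative, so that the
empirical part may be truncated for free. -/
lemma genGap_le_empGap_truncLoss (D : Measure (EuclideanSpace ℝ (Fin d) × Y))
    [IsProbabilityMeasure D] {loss : (Fin C → ℝ) → Y → ℝ}
    (hl : Measurable (Function.uncurry loss)) {E R q : ℝ} (hE0 : 0 ≤ E)
    (hE : ∀ z y, 0 ≤ loss z y ∧ loss z y ≤ E)
    (hR : D.real {z | R < ‖z.1‖} ≤ q) (S : Fin N → EuclideanSpace ℝ (Fin d) × Y)
    (A : Matrix (Fin C) (Fin d) ℝ) :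
    genGap D loss S A ≤ empGap D S (truncLoss loss R (vecOf A)) + E * q := by
  have hms : MeasurableSet {z : EuclideanSpace ℝ (Fin d) × Y | R < ‖z.1‖} :=
    measurableSet_lt measurable_const (by fun_prop)
  have hi1 : Integrable (truncLoss loss R (vecOf A)) D :=
    integrable_of_abs_le D (measurable_truncLoss hl R) (abs_truncLoss_le hE0 hE R) _
  have hi2 : Integrable (Set.indicator {z : EuclideanSpace ℝ (Fin d) × Y | R < ‖z.1‖}
      fun _ => E) D := (integrable_const E).indicator hms
  have h1 : ∫ z, loss (A *ᵥ z.1.ofLp) z.2 ∂D ≤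
      ∫ z, (truncLoss loss R (vecOf A) z +
        Set.indicator {z : EuclideanSpace ℝ (Fin d) × Y | R < ‖z.1‖} (fun _ => E) z) ∂D := by
    refine integral_mono_of_nonneg (Eventually.of_forall fun z => (hE _ _).1) (hi1.add hi2)
      (Eventually.of_forall fun z => ?_)
    simp only [truncLoss, Set.indicator, Set.mem_ofPred_eq, matOf_vecOf]
    by_cases h : ‖z.1‖ ≤ R
    · simp [h, not_lt.2 h]
    · simpa [h, not_le.1 h] using (hE _ _).2
  rw [integral_add hi1 hi2, integral_indicator_const _ hms, smul_eq_mul] at h1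
  have h2 : ∑ i, truncLoss loss R (vecOf A) (S i) ≤
      ∑ i, loss (A *ᵥ (S i).1.ofLp) (S i).2 := by
    refine Finset.sum_le_sum fun i _ => ?_
    simp only [truncLoss, matOf_vecOf]
    split_ifs
    · exact le_rfl
    · exact (hE _ _).1
  have h3 : D.real {z | R < ‖z.1‖} * E ≤ E * q := by rw [mul_comm]; gcongr
  have h4 := mul_le_mul_of_nonneg_left h2 (by positivity : 0 ≤ 1 / (N : ℝ))
  unfold genGap empGap
  linarith

lemma genGap_le (D : Measure (EuclideanSpace ℝ (Fin d) × Y))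
    [IsProbabilityMeasure D] {loss : (Fin C → ℝ) → Y → ℝ} {E : ℝ}
    (hE : ∀ z y, 0 ≤ loss z y ∧ loss z y ≤ E) (S : Fin N → EuclideanSpace ℝ (Fin d) × Y)
    (A : Matrix (Fin C) (Fin d) ℝ) : genGap D loss S A ≤ E := by
  have h1 : ∫ z, loss (A *ᵥ z.1.ofLp) z.2 ∂D ≤ ∫ _, E ∂D :=
    integral_mono_of_nonneg (Eventually.of_forall fun z => (hE _ _).1) (integrable_const E)
      (Eventually.of_forall fun z => (hE _ _).2)
  have h2 : 0 ≤ ∑ i, loss (A *ᵥ (S i).1.ofLp) (S i).2 := Finset.sum_nonneg fun i _ => (hE _ _).1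
  have h3 : 0 ≤ 1 / (N : ℝ) * ∑ i, loss (A *ᵥ (S i).1.ofLp) (S i).2 := by positivity
  simp only [integral_const, probReal_univ, smul_eq_mul, one_mul] at h1
  unfold genGap
  linarith

end Truncation

/-! ### A countable family of low-rank centers -/

/-- Indices of the centers: a rank `k`, a resolution `2⁻ⁱ`, and two factors with entries on a grid
of that resolution in `[-2ⁱ, 2ⁱ]`. -/
abbrev CenterIndex (C d : ℕ) : Type :=
  Σ p : ℕ × ℕ, (Fin C → Fin p.1 → Fin (2 * 4 ^ p.2 + 1)) × (Fin p.1 → Fin d → Fin (2 * 4 ^ p.2 + 1))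

/-- The grid point with a given index. -/
noncomputable def gridPoint (i : ℕ) (n : Fin (2 * 4 ^ i + 1)) : ℝ := ((n : ℝ) - 4 ^ i) / 2 ^ i

/-- The low-rank matrix with a given index. -/
noncomputable def centerMatrix {C d : ℕ} (α : CenterIndex C d) : Matrix (Fin C) (Fin d) ℝ :=
  Matrix.of fun x y => ∑ l, gridPoint α.1.2 (α.2.1 x l) * gridPoint α.1.2 (α.2.2 l y)

/-- The prior weight of a center: geometric in the rank and the resolution, uniform otherwise. -/
noncomputable def centerWeight {C d : ℕ} (α : CenterIndex C d) : ℝ :=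
  (1 / 2) ^ (α.1.1 + 1) * (1 / 2) ^ (α.1.2 + 1) *
    ((((2 * 4 ^ α.1.2 + 1 : ℕ) : ℝ)) ^ (α.1.1 * (C + d)))⁻¹

lemma centerWeight_pos {C d : ℕ} (α : CenterIndex C d) : 0 < centerWeight α := by
  unfold centerWeight
  positivity

lemma tsum_centerWeight_le (C d : ℕ) :
    ∑' α : CenterIndex C d, ENNReal.ofReal (centerWeight α) ≤ 1 := by
  rw [ENNReal.tsum_sigma']
  have h1 : ∀ p : ℕ × ℕ, ∑' b : (Fin C → Fin p.1 → Fin (2 * 4 ^ p.2 + 1)) ×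
      (Fin p.1 → Fin d → Fin (2 * 4 ^ p.2 + 1)),
      ENNReal.ofReal (centerWeight (⟨p, b⟩ : CenterIndex C d)) =
      ENNReal.ofReal ((1 / 2) ^ (p.1 + 1) * (1 / 2) ^ (p.2 + 1)) := fun p => by
    simp only [centerWeight]
    rw [tsum_fintype, Finset.sum_const, nsmul_eq_mul, Finset.card_univ, Fintype.card_prod]
    simp only [Fintype.card_fun, Fintype.card_fin]
    rw [← ENNReal.ofReal_natCast, ← ENNReal.ofReal_mul (by positivity)]
    congr 1
    push_cast
    rw [← pow_mul, ← pow_mul, ← pow_add, show p.1 * C + d * p.1 = p.1 * (C + d) by ring,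
      mul_comm, mul_assoc, inv_mul_cancel₀ (by positivity), mul_one]
  simp_rw [h1]
  refine tsum_ofReal_mul_geometric_le (w := fun k : ℕ => (1 / 2) ^ (k + 1))
    (fun k => by positivity) ?_
  have hs : Summable fun j : ℕ => (1 / 2 : ℝ) ^ (j + 1) :=
    (summable_nat_add_iff 1).2 summable_geometric_two
  rw [← ENNReal.ofReal_tsum_of_nonneg (fun _ => by positivity) hs]
  simp_rw [pow_succ]
  rw [tsum_mul_right, tsum_geometric_two]
  norm_num

lemma centerWeight_le_one {C d : ℕ} (α : CenterIndex C d) : centerWeight α ≤ 1 := by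
  have := (ENNReal.le_tsum α).trans (tsum_centerWeight_le C d)
  simpa using this

lemma exists_gridPoint {i : ℕ} {p : ℝ} (hp : |p| ≤ 2 ^ i) :
    ∃ n, |p - gridPoint i n| ≤ 1 / 2 ^ i := by
  have h4 : (4 : ℝ) ^ i = 2 ^ i * 2 ^ i := by rw [← mul_pow]; norm_num
  have h2 : (0 : ℝ) < 2 ^ i := by positivity
  obtain ⟨hl, hu⟩ := abs_le.1 hp
  have hl' : 0 ≤ p * 2 ^ i + 4 ^ i := by rw [h4]; nlinarith
  have hu' : p * 2 ^ i + 4 ^ i ≤ 2 * 4 ^ i := by rw [h4]; nlinarith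
  have hfl := Nat.floor_le hl'
  have hlt := Nat.lt_floor_add_one (p * 2 ^ i + 4 ^ i)
  have hb : ⌊p * 2 ^ i + 4 ^ i⌋₊ < 2 * 4 ^ i + 1 := by
    rw [Nat.lt_succ_iff]
    have := hfl.trans hu'
    exact_mod_cast this
  refine ⟨⟨_, hb⟩, ?_⟩
  simp only [gridPoint]
  rw [show p - ((⌊p * 2 ^ i + 4 ^ i⌋₊ : ℝ) - 4 ^ i) / 2 ^ i =
    (p * 2 ^ i + 4 ^ i - ⌊p * 2 ^ i + 4 ^ i⌋₊) / 2 ^ i by field_simp; ring, abs_div,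
    abs_of_pos h2]
  gcongr
  rw [abs_le]
  constructor <;> linarith

/-- Rounding the two factors of a low-rank matrix. -/
lemma exists_center_near {C d k i : ℕ} (P : Matrix (Fin C) (Fin k) ℝ) (Q : Matrix (Fin k) (Fin d) ℝ)
    {s : ℝ} (hs : 0 ≤ s) (hP : ∀ x l, |P x l| ≤ s) (hQ : ∀ l y, |Q l y| ≤ 1) (hi : s ≤ 2 ^ i) :
    ∃ α : CenterIndex C d, α.1 = (k, i) ∧
      ‖vecOf (P * Q) - vecOf (centerMatrix α)‖ ≤ C * d * (k * (s + 2)) / 2 ^ i := by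
  have h1i : (1 : ℝ) ≤ 2 ^ i := one_le_pow₀ (by norm_num)
  choose U hU using fun x l => exists_gridPoint ((hP x l).trans hi)
  choose W hW using fun l y => exists_gridPoint ((hQ l y).trans h1i)
  refine ⟨⟨(k, i), U, W⟩, rfl, ?_⟩
  have hinv : (1 : ℝ) / 2 ^ i ≤ 1 := by rw [div_le_one (by positivity)]; exact h1i
  have hent : ∀ x y, |(P * Q) x y - centerMatrix ⟨(k, i), U, W⟩ x y| ≤ k * (s + 2) / 2 ^ i := by
    intro x y
    simp only [Matrix.mul_apply, centerMatrix, Matrix.of_apply]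
    rw [← Finset.sum_sub_distrib]
    refine (Finset.abs_sum_le_sum_abs _ _).trans ((Finset.sum_le_sum fun l _ =>
      (?_ : _ ≤ (s + 2) / 2 ^ i)).trans (by simp [mul_div_assoc]))
    have hg : |gridPoint i (U x l)| ≤ s + 1 := by
      have := abs_sub_abs_le_abs_sub (gridPoint i (U x l)) (P x l)
      rw [abs_sub_comm] at this
      linarith [hP x l, hU x l]
    calc |P x l * Q l y - gridPoint i (U x l) * gridPoint i (W l y)|
        = |(P x l - gridPoint i (U x l)) * Q l y +
            gridPoint i (U x l) * (Q l y - gridPoint i (W l y))| := by congr 1; ring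
      _ ≤ |P x l - gridPoint i (U x l)| * |Q l y| +
            |gridPoint i (U x l)| * |Q l y - gridPoint i (W l y)| := by
          rw [← abs_mul, ← abs_mul]; exact abs_add_le _ _
      _ ≤ 1 / 2 ^ i * 1 + (s + 1) * (1 / 2 ^ i) := by
          gcongr
          · exact hU x l
          · exact hQ l y
          · exact hW l y
      _ = _ := by ring
  rw [← vecOf_sub]
  refine abs_le_of_sq_le_sq' ?_ (by positivity) |>.2
  rw [norm_vecOf_sq, frobSq]
  have hb : 0 ≤ k * (s + 2) / 2 ^ i := by positivity
  calc ∑ x, ∑ y, (P * Q - centerMatrix ⟨(k, i), U, W⟩) x y ^ 2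
      ≤ ∑ _x : Fin C, ∑ _y : Fin d, (k * (s + 2) / 2 ^ i) ^ 2 := by
        refine Finset.sum_le_sum fun x _ => Finset.sum_le_sum fun y _ => ?_
        rw [Matrix.sub_apply]
        exact sq_le_sq' (abs_le.1 (hent x y)).1 (abs_le.1 (hent x y)).2
    _ = ((C * d : ℕ) : ℝ) * (k * (s + 2) / 2 ^ i) ^ 2 := by
        simp [mul_assoc]
    _ ≤ ((C * d : ℕ) : ℝ) ^ 2 * (k * (s + 2) / 2 ^ i) ^ 2 := by
        gcongr
        exact_mod_cast Nat.le_self_pow two_ne_zero _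
    _ = _ := by push_cast; ring

/-! ### Splitting a matrix at a singular value threshold -/

lemma norm_apply_le_spectralNorm2 {m n : ℕ} (A : Matrix (Fin m) (Fin n) ℝ)
    (x : EuclideanSpace ℝ (Fin n)) : ‖A.toEuclideanLin x‖ ≤ spectralNorm2 A * ‖x‖ :=
  (LinearMap.toContinuousLinearMap A.toEuclideanLin).le_opNorm x

lemma abs_coord_le_norm {n : ℕ} (x : EuclideanSpace ℝ (Fin n)) (i : Fin n) : |x i| ≤ ‖x‖ :=
  PiLp.norm_apply_le x i

/-- A matrix is a sum of a matrix of rank `k`, where `k` counts the singular values above `τ`, and a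
matrix of small Frobenius norm. -/
lemma exists_threshold_decomposition {m n : ℕ} (A : Matrix (Fin m) (Fin n) ℝ) {τ : ℝ} (hτ : 0 ≤ τ) :
    ∃ (k : ℕ) (P : Matrix (Fin m) (Fin k) ℝ) (Q : Matrix (Fin k) (Fin n) ℝ),
      k ≤ min m n ∧ (∀ x l, |P x l| ≤ spectralNorm2 A) ∧ (∀ l y, |Q l y| ≤ 1) ∧
      frobSq (A - P * Q) ≤ (min m n : ℕ) * τ ^ 2 ∧
      ∀ p : ℝ, 0 < p → k * τ ^ p ≤ schattenSum p A := by
  obtain ⟨v, hv⟩ := exists_singular_basis A.toEuclideanLin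
  have hnorm := norm_singular_apply hv
  set σ := A.toEuclideanLin.singularValues with hσ
  set s : Finset (Fin n) := {i | τ < σ i} with hs
  have hmem : ∀ i, i ∈ s ↔ τ < σ i := fun i => by simp [hs]
  have hlt : ∀ i ∈ s, (i : ℕ) < min m n := fun i hi => by
    have h1 := (singularValues_pos_iff_lt_rank A i).1 (hτ.trans_lt ((hmem i).1 hi))
    exact h1.trans_le (rank_le_min A)
  have hsum : ∀ g : ℕ → ℝ, ∑ i ∈ s, g i = ∑ j ∈ s.map Fin.valEmbedding, g j := fun g => by simp
  have hsub : s.map Fin.valEmbedding ⊆ Finset.range (min m n) := fun j hj => by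
    obtain ⟨i, hi, rfl⟩ := Finset.mem_map.1 hj
    exact Finset.mem_range.2 (hlt i hi)
  let e : Fin s.card ≃ s := s.equivFin.symm
  have hre : ∀ g : Fin n → ℝ, ∑ l, g (e l) = ∑ i ∈ s, g i := fun g => by
    rw [e.sum_comp fun i : s => g i, Finset.sum_coe_sort]
  refine ⟨s.card, Matrix.of fun x l => A.toEuclideanLin (v (e l)) x,
    Matrix.of fun l y => v (e l) y, ?_, fun x l => ?_, fun l y => ?_, ?_, fun p hp => ?_⟩
  · have := Finset.card_le_card hsub
    simpa using this
  · refine (abs_coord_le_norm _ _).trans ((norm_apply_le_spectralNorm2 _ _).trans ?_)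
    rw [v.orthonormal.1, mul_one]
  · refine (abs_coord_le_norm _ _).trans ?_
    rw [v.orthonormal.1]
  · have happ : ∀ j, (A - (Matrix.of fun x l => A.toEuclideanLin (v (e l)) x) *
        (Matrix.of fun l y => v (e l) y)).toEuclideanLin (v j) =
        if j ∈ s then 0 else A.toEuclideanLin (v j) := fun j => by
      have h1 : ((Matrix.of fun l y => v (e l) y) : Matrix (Fin s.card) (Fin n) ℝ).toEuclideanLin
          (v j) = WithLp.toLp 2 fun l => if (e l : Fin n) = j then (1 : ℝ) else 0 := by
        ext l
        rw [toEuclideanLin_apply_eq_inner]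
        exact OrthonormalBasis.inner_eq_ite v _ _
      rw [map_sub, LinearMap.sub_apply, toEuclideanLin_mul_apply, h1]
      have h2 : ∀ x, (Matrix.of fun x l => A.toEuclideanLin (v (e l)) x).toEuclideanLin
          (WithLp.toLp 2 fun l => if (e l : Fin n) = j then (1 : ℝ) else 0) x =
          if j ∈ s then A.toEuclideanLin (v j) x else 0 := fun x => by
        have h3 := hre fun i => if i = j then A.toEuclideanLin (v i) x else 0
        rw [Finset.sum_ite_eq'] at h3
        rw [← h3, Matrix.ofLp_toLpLin, Matrix.toLin'_apply]
        simp [Matrix.mulVec, dotProduct]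
      ext x
      rw [PiLp.sub_apply, h2]
      split_ifs with h <;> simp
    rw [frobSq_eq_sum_basis _ v]
    simp only [happ]
    have h2 : ∀ j, ‖if j ∈ s then (0 : EuclideanSpace ℝ (Fin m)) else A.toEuclideanLin (v j)‖ ^ 2 ≤
        if (j : ℕ) < min m n then τ ^ 2 else 0 := fun j => by
      by_cases hj : j ∈ s
      · rw [if_pos hj, if_pos (hlt j hj)]
        simp [sq_nonneg]
      · rw [if_neg hj, hnorm]
        split_ifs with h
        · have h3 : σ j ≤ τ := not_lt.1 fun h4 => hj ((hmem j).2 h4)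
          exact pow_le_pow_left₀ (LinearMap.singularValues_nonneg _ _) h3 2
        · rw [hσ, singularValues_eq_zero_of_rank_le A ((rank_le_min A).trans (not_lt.1 h))]
          norm_num
    refine (Finset.sum_le_sum fun j _ => h2 j).trans ?_
    rw [sum_fin_ite_lt (min_le_right m n) fun _ => τ ^ 2]
    simp
  · calc (s.card : ℝ) * τ ^ p = ∑ i ∈ s, τ ^ p := by simp
      _ ≤ ∑ i ∈ s, σ i ^ p := Finset.sum_le_sum fun i hi =>
          Real.rpow_le_rpow hτ ((hmem i).1 hi).le hp.le
      _ ≤ schattenSum p A := by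
          rw [hsum fun j => σ j ^ p, schattenSum]
          exact Finset.sum_le_sum_of_subset_of_nonneg hsub fun j _ _ =>
            Real.rpow_nonneg (LinearMap.singularValues_nonneg _ _) _

/-! ### The threshold that balances the two parts -/

lemma rank_pos_of_schattenSum_pos {m n : ℕ} {p : ℝ} (hp : p ≠ 0) {A : Matrix (Fin m) (Fin n) ℝ}
    (h : 0 < schattenSum p A) : 0 < A.rank := by
  by_contra h0
  rw [schattenSum_eq_sum_rank hp, Nat.eq_zero_of_not_pos h0] at h
  simp at h

lemma frobSq_eq_zero_of_schattenSum_eq_zero {m n : ℕ} {p : ℝ} (hp : p ≠ 0)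
    {A : Matrix (Fin m) (Fin n) ℝ} (h : schattenSum p A = 0) : frobSq A = 0 := by
  obtain ⟨v, hv⟩ := exists_singular_basis A.toEuclideanLin
  have hr : A.rank = 0 := by
    by_contra h0
    have hpos : 0 < A.rank := Nat.pos_of_ne_zero h0
    rw [schattenSum_eq_sum_rank hp] at h
    have h1 := (Finset.sum_eq_zero_iff_of_nonneg fun i _ =>
      Real.rpow_nonneg (LinearMap.singularValues_nonneg A.toEuclideanLin i) p).1 h 0
      (Finset.mem_range.2 hpos)
    have h2 := Real.rpow_pos_of_pos ((singularValues_pos_iff_lt_rank A 0).2 hpos) p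
    exact h2.ne' h1
  rw [frobSq_eq_sum_basis A v]
  refine Finset.sum_eq_zero fun i _ => ?_
  rw [norm_singular_apply hv, singularValues_eq_zero_of_rank_le A (hr ▸ Nat.zero_le _)]
  norm_num

namespace LinearNetwork

variable {d C w : ℕ}

lemma index_pos (F : LinearNetwork d C w) : 0 < F.index := by
  have hL : (0 : ℝ) < F.depth := by exact_mod_cast F.depth_pos
  unfold index
  positivity

/-- The balancing threshold `τ = √(T / min(C, d)) / a`, where `T` is the Schatten rate, satisfies
`τ^p T = ‖A‖_{S_p}^p (C + d)`. -/
lemma threshold_rpow_mul_schattenRate (F : LinearNetwork d C w) {a : ℝ} (ha : 0 < a)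
    (hS : 0 < schattenSum F.index F.toMatrix) :
    0 < F.schattenRate a ∧
      (√(F.schattenRate a / (min C d : ℕ)) / a) ^ F.index * F.schattenRate a =
        schattenSum F.index F.toMatrix * ((C : ℝ) + d) := by
  have hL : (0 : ℝ) < F.depth := by exact_mod_cast F.depth_pos
  have hm : 0 < min C d :=
    (rank_pos_of_schattenSum_pos F.index_pos.ne' hS).trans_le (rank_le_min _)
  have hm' : (0 : ℝ) < (min C d : ℕ) := by exact_mod_cast hm
  have hC : (0 : ℝ) < C := by exact_mod_cast hm.trans_le (min_le_left _ _)
  have hd : (0 : ℝ) < d := by exact_mod_cast hm.trans_le (min_le_right _ _)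
  have hCd : (0 : ℝ) < (C : ℝ) + d := by positivity
  have hrate := F.schattenRate_eq a
  rw [show (min (C : ℝ) (d : ℝ)) = ((min C d : ℕ) : ℝ) by push_cast; rfl] at hrate
  set T := F.schattenRate a with hT
  set S := schattenSum F.index F.toMatrix with hSdef
  set m : ℝ := ((min C d : ℕ) : ℝ) with hmdef
  have hT0 : 0 < T := by rw [hrate]; positivity
  refine ⟨hT0, ?_⟩
  have hlogT : Real.log T = 2 / ((F.depth : ℝ) + 1) * Real.log a +
      F.depth / (F.depth + 1) * Real.log S + 1 / ((F.depth : ℝ) + 1) * Real.log m +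
      F.depth / (F.depth + 1) * Real.log ((C : ℝ) + d) := by
    rw [hrate, Real.log_mul (by positivity) (by positivity),
      Real.log_mul (by positivity) (by positivity), Real.log_mul (by positivity) (by positivity),
      Real.log_rpow ha, Real.log_rpow hS, Real.log_rpow hm', Real.log_rpow hCd]
  refine Real.log_injOn_pos (Set.mem_Ioi.2 (by positivity)) (Set.mem_Ioi.2 (by positivity)) ?_
  rw [Real.log_mul (by positivity) hT0.ne', Real.log_rpow (by positivity),
    Real.log_div (by positivity) ha.ne', Real.log_sqrt (by positivity),
    Real.log_div hT0.ne' hm'.ne', Real.log_mul hS.ne' hCd.ne', hlogT, index]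
  field_simp
  ring

/-- At the balancing threshold, both the parameter count of the low-rank part and the squared
Frobenius norm of the remainder, on the scale `a`, are at most the Schatten rate. -/
lemma exists_balanced_decomposition (F : LinearNetwork d C w) {a : ℝ} (ha : 0 < a) :
    ∃ (k : ℕ) (P : Matrix (Fin C) (Fin k) ℝ) (Q : Matrix (Fin k) (Fin d) ℝ),
      k ≤ min C d ∧ (∀ x l, |P x l| ≤ spectralNorm2 F.toMatrix) ∧ (∀ l y, |Q l y| ≤ 1) ∧
      a ^ 2 * frobSq (F.toMatrix - P * Q) ≤ F.schattenRate a ∧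
      (k : ℝ) * ((C : ℝ) + d) ≤ F.schattenRate a := by
  rcases (schattenSum_nonneg F.index F.toMatrix).eq_or_lt with h | h
  · refine ⟨0, 0, 0, Nat.zero_le _, fun _ l => l.elim0, fun l => l.elim0, ?_, ?_⟩
    · rw [Matrix.zero_mul, sub_zero,
        frobSq_eq_zero_of_schattenSum_eq_zero F.index_pos.ne' h.symm, mul_zero]
      exact F.schattenRate_nonneg ha.le
    · rw [Nat.cast_zero, zero_mul]
      exact F.schattenRate_nonneg ha.le
  · obtain ⟨hT, hτ⟩ := F.threshold_rpow_mul_schattenRate ha h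
    have hm : 0 < min C d :=
      (rank_pos_of_schattenSum_pos F.index_pos.ne' h).trans_le (rank_le_min _)
    have hm' : (0 : ℝ) < (min C d : ℕ) := by exact_mod_cast hm
    set T := F.schattenRate a with hTdef
    set τ := √(T / (min C d : ℕ)) / a with hτdef
    have hτ0 : 0 < τ := by positivity
    obtain ⟨k, P, Q, h1, h2, h3, h4, h5⟩ := exists_threshold_decomposition F.toMatrix hτ0.le
    refine ⟨k, P, Q, h1, h2, h3, ?_, ?_⟩
    · have : a ^ 2 * ((min C d : ℕ) * τ ^ 2) = T := by
        rw [hτdef, div_pow, Real.sq_sqrt (by positivity)]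
        field_simp
      rw [← this]
      gcongr
    · have h6 := h5 F.index F.index_pos
      have h7 : 0 < τ ^ F.index := Real.rpow_pos_of_pos hτ0 _
      refine le_of_mul_le_mul_left ?_ h7
      rw [hτ]
      calc τ ^ F.index * (k * ((C : ℝ) + d)) = k * τ ^ F.index * ((C : ℝ) + d) := by ring
        _ ≤ _ := by gcongr

end LinearNetwork

/-! ### Bookkeeping of the logarithmic factors -/

lemma spectralNorm2_nonneg {m n : ℕ} (A : Matrix (Fin m) (Fin n) ℝ) : 0 ≤ spectralNorm2 A :=
  norm_nonneg _

lemma clog_two_le {N : ℕ} {q : ℝ} (hN : (N : ℝ) ≤ q) (hq : 1 ≤ Real.log q) :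
    (Nat.clog 2 N : ℝ) ≤ 3 * Real.log q := by
  rcases Nat.lt_or_ge 1 N with h | h
  · have h1 := Nat.pow_pred_clog_lt_self (b := 2) (by norm_num) h
    have h2 : (2 : ℝ) ^ (Nat.clog 2 N).pred ≤ q := by
      refine le_trans ?_ hN
      exact_mod_cast h1.le
    have h3 := Real.log_le_log (by positivity) h2
    rw [Real.log_pow] at h3
    have h4 : (Nat.clog 2 N : ℝ) ≤ ((Nat.clog 2 N).pred : ℝ) + 1 := by
      exact_mod_cast (by rw [Nat.pred_eq_sub_one]; omega :
        Nat.clog 2 N ≤ (Nat.clog 2 N).pred + 1)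
    have h5 := Real.log_two_gt_d9
    have h6 : (0 : ℝ) ≤ ((Nat.clog 2 N).pred : ℝ) := Nat.cast_nonneg _
    nlinarith
  · rw [Nat.clog_of_right_le_one h]
    push_cast
    linarith

lemma neg_log_centerWeight {C d : ℕ} (α : CenterIndex C d) :
    -Real.log (centerWeight α) = (α.1.1 + 1) * Real.log 2 + (α.1.2 + 1) * Real.log 2 +
      α.1.1 * (C + d) * Real.log (2 * 4 ^ α.1.2 + 1) := by
  unfold centerWeight
  rw [Real.log_mul (by positivity) (by positivity), Real.log_mul (by positivity) (by positivity),
    Real.log_inv, Real.log_pow, Real.log_pow, Real.log_pow, one_div, Real.log_inv]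
  push_cast
  ring

/-- The number of grid points at a resolution `2⁻ⁱ` is polynomial in `2ⁱ`. -/
lemma log_grid_card_le (i : ℕ) :
    Real.log (2 * 4 ^ i + 1) ≤ 2 * ((i + 1) * Real.log 2) := by
  have h1 : (2 * 4 ^ i + 1 : ℝ) ≤ 2 ^ (2 * (i + 1)) := by
    rw [pow_mul, pow_succ]
    have : (1 : ℝ) ≤ 4 ^ i := one_le_pow₀ (by norm_num)
    norm_num
    linarith
  refine (Real.log_le_log (by positivity) h1).trans (le_of_eq ?_)
  rw [Real.log_pow]
  push_cast
  ring

/-- Every quantity entering the rounding resolution is at most `q`, so that the resolution is at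
most a power of `q`. -/
lemma resolution_le {q C d k s lam R b : ℝ} (hq : 4 ≤ q) (hC : 0 ≤ C) (hd : 0 ≤ d) (hk : 0 ≤ k)
    (hs : 0 ≤ s) (hlam : 0 ≤ lam) (hR : 0 ≤ R) (hRb : R ≤ b) (hkq : k ≤ q) (hCq : C ≤ q)
    (hdq : d ≤ q) (hsq : s + 2 ≤ q) (hlq : 1 + lam ≤ q) (hbq : 1 + b ≤ q) :
    4 * (C * d * (k * (s + 2)) * (1 + lam * R)) ≤ q ^ 7 := by
  have h1 : lam * R ≤ lam * b := by gcongr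
  have hlR : 1 + lam * R ≤ q * q := by
    calc 1 + lam * R ≤ (1 + lam) * (1 + b) := by
          have e : (1 + lam) * (1 + b) = 1 + lam + b + lam * b := by ring
          linarith
      _ ≤ q * q := by gcongr; linarith
  calc 4 * (C * d * (k * (s + 2)) * (1 + lam * R)) ≤ q * (q * q * (q * q) * (q * q)) := by gcongr
    _ = q ^ 7 := by ring

lemma log_resolution_le {q X : ℝ} {n : ℕ} (hn : 2 ^ n ≤ X) (hX : 4 * X ≤ q ^ 7) :
    ((n + 1 : ℕ) + 1 : ℝ) * Real.log 2 ≤ 7 * Real.log q := by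
  have e1 : (2 : ℝ) ^ (n + 2) ≤ q ^ 7 := by
    rw [pow_add]
    linarith
  have e2 := Real.log_le_log (by positivity) e1
  rw [Real.log_pow, Real.log_pow] at e2
  push_cast at e2 ⊢
  linarith

/-- Some center is close to the end-to-end matrix on the scale of the rate, and its weight is not
too small. -/
lemma exists_good_center {d C w N : ℕ} (hN : 0 < N) (F : LinearNetwork d C w) {lam R b : ℝ}
    (hlam : 0 ≤ lam) (hR : 0 ≤ R) (hlR : 0 < lam * R) (hRb : R ≤ b) :
    ∃ α : CenterIndex C d,
      lam * R * ‖vecOf F.toMatrix - vecOf (centerMatrix α)‖ ≤ 2 * √(F.schattenRate (lam * b)) ∧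
      -Real.log (centerWeight α) ≤ Real.log 4 + 26 *
        Real.log (3 + N + C + d + lam + b + spectralNorm2 F.toMatrix) *
          F.schattenRate (lam * b) := by
  have hb : 0 ≤ b := hR.trans hRb
  have ha : 0 < lam * b := hlR.trans_le (by gcongr)
  obtain ⟨k, P, Q, hk, hP, hQ, h4, h5⟩ := F.exists_balanced_decomposition ha
  set s := spectralNorm2 F.toMatrix with hs
  have hs0 : 0 ≤ s := spectralNorm2_nonneg _
  set T := F.schattenRate (lam * b) with hT
  have hT0 : 0 ≤ T := F.schattenRate_nonneg ha.le
  set q : ℝ := 3 + N + C + d + lam + b + s with hq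
  have hN' : (1 : ℝ) ≤ N := by exact_mod_cast hN
  have hC0 : (0 : ℝ) ≤ C := C.cast_nonneg
  have hd0 : (0 : ℝ) ≤ d := d.cast_nonneg
  have hq4 : 4 ≤ q := by rw [hq]; linarith
  have hl0 : 0 ≤ Real.log q := Real.log_nonneg (by linarith)
  have hfar : lam * R * ‖vecOf (F.toMatrix - P * Q)‖ ≤ √T := by
    refine Real.le_sqrt_of_sq_le ?_
    rw [mul_pow, norm_vecOf_sq]
    refine le_trans ?_ h4
    have := frobSq_nonneg (F.toMatrix - P * Q)
    gcongr
  rcases Nat.eq_zero_or_pos k with hk0 | hkpos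
  · subst hk0
    refine ⟨⟨(0, 0), fun _ l => l.elim0, fun l => l.elim0⟩, ?_, ?_⟩
    · have e1 : centerMatrix (⟨(0, 0), fun _ l => l.elim0, fun l => l.elim0⟩ : CenterIndex C d) =
          P * Q := by
        ext x y
        simp [centerMatrix, Matrix.mul_apply]
      rw [e1, ← vecOf_sub]
      have := Real.sqrt_nonneg T
      linarith
    · rw [neg_log_centerWeight, show (4 : ℝ) = 2 ^ 2 by norm_num, Real.log_pow]
      have : 0 ≤ 26 * Real.log q * T := by positivity
      simp only [Nat.cast_zero, zero_add, zero_mul, add_zero, Nat.cast_ofNat]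
      linarith
  · have hkR : (1 : ℝ) ≤ k := by exact_mod_cast hkpos
    have hC1 : (1 : ℝ) ≤ C := by exact_mod_cast hkpos.trans_le (hk.trans (min_le_left _ _))
    have hd1 : (1 : ℝ) ≤ d := by exact_mod_cast hkpos.trans_le (hk.trans (min_le_right _ _))
    have hkC : (k : ℝ) ≤ C := by exact_mod_cast hk.trans (min_le_left _ _)
    have hT1 : 1 ≤ T := by nlinarith
    -- The resolution at which the rounding error is invisible for inputs of norm `R`.
    set X : ℝ := C * d * (k * (s + 2)) * (1 + lam * R) with hX
    have hCd : (1 : ℝ) ≤ C * d := one_le_mul_of_one_le_of_one_le hC1 hd1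
    have hks : s + 2 ≤ k * (s + 2) := by nlinarith
    have hCdks : s + 2 ≤ C * d * (k * (s + 2)) := by nlinarith
    have hXs : s + 2 ≤ X := by rw [hX]; nlinarith
    obtain ⟨n, hn1, hn2⟩ := exists_nat_pow_near (x := X) (y := 2) (by linarith) (by norm_num)
    obtain ⟨α, hα, hnear⟩ := exists_center_near (i := n + 1) P Q hs0 hP hQ (by linarith)
    refine ⟨α, ?_, ?_⟩
    · have h6 : lam * R * ‖vecOf (P * Q) - vecOf (centerMatrix α)‖ ≤ 1 := by
        have h7 : C * d * (k * (s + 2)) / 2 ^ (n + 1) * (1 + lam * R) ≤ 1 := by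
          rw [div_mul_eq_mul_div, div_le_one (by positivity)]
          exact hn2.le
        have h8 := norm_nonneg (vecOf (P * Q) - vecOf (centerMatrix α))
        calc _ ≤ (1 + lam * R) * (C * d * (k * (s + 2)) / 2 ^ (n + 1)) := by
              gcongr
              linarith
          _ ≤ 1 := by rw [mul_comm]; exact h7
      have h9 : ‖vecOf F.toMatrix - vecOf (centerMatrix α)‖ ≤ ‖vecOf (F.toMatrix - P * Q)‖ +
          ‖vecOf (P * Q) - vecOf (centerMatrix α)‖ := by
        rw [vecOf_sub]
        exact norm_sub_le_norm_sub_add_norm_sub _ _ _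
      have h10 : 1 ≤ √T := Real.one_le_sqrt.2 hT1
      have h11 := mul_le_mul_of_nonneg_left h9 hlR.le
      linarith
    · rw [neg_log_centerWeight, hα]
      simp only
      have hres : ((n + 1 : ℕ) + 1 : ℝ) * Real.log 2 ≤ 7 * Real.log q := by
        refine log_resolution_le hn1 (resolution_le (by linarith) C.cast_nonneg d.cast_nonneg
          (Nat.cast_nonneg k) hs0 hlam hR hRb ?_ ?_ ?_ ?_ ?_ ?_)
        · exact hkC.trans (by rw [hq]; linarith)
        all_goals rw [hq]; linarith
      have hlog2 : Real.log 2 ≤ Real.log q := Real.log_le_log (by norm_num) (by linarith)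
      have hcard := log_grid_card_le (n + 1)
      have hlog4 : 0 ≤ Real.log 4 := Real.log_nonneg (by norm_num)
      have hkT : (k : ℝ) ≤ T := by nlinarith
      have t1 : ((k : ℝ) + 1) * Real.log 2 ≤ 2 * Real.log q * T := by
        calc ((k : ℝ) + 1) * Real.log 2 ≤ (T + T) * Real.log q := by gcongr
          _ = _ := by ring
      have t2 : 7 * Real.log q ≤ 7 * Real.log q * T := le_mul_of_one_le_right (by positivity) hT1
      have t3 : (k : ℝ) * (C + d) * Real.log (2 * 4 ^ (n + 1) + 1) ≤ T * (14 * Real.log q) := by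
        gcongr
        · exact Real.log_nonneg (by
            have : (0 : ℝ) ≤ 2 * 4 ^ (n + 1) := by positivity
            linarith)
        · linarith
      linarith

/-! ### The generalization bound -/

lemma log_two_le_log_two_div {δ : ℝ} (hδ : 0 < δ) (hδ1 : δ < 1) :
    Real.log 2 ≤ Real.log (2 / δ) := by
  refine Real.log_le_log (by norm_num) ?_
  rw [le_div_iff₀ hδ]
  linarith

/-- The confidence term with the prior weight `1/4`, absorbed into a multiple of `log(2/δ)`. -/
lemma log_confidence_le {δ : ℝ} (hδ : 0 < δ) (hδ1 : δ < 1) {w x : ℝ} (hw : 0 < w)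
    (h : -Real.log w ≤ Real.log 4 + x) :
    Real.log (12 / (δ / 2 * w)) ≤ 7 * Real.log (2 / δ) + x := by
  have h1 := log_two_le_log_two_div hδ hδ1
  have e1 : Real.log (12 / (δ / 2 * w)) = Real.log 12 + Real.log (2 / δ) - Real.log w := by
    rw [show 12 / (δ / 2 * w) = 12 * (2 / δ) / w by field_simp,
      Real.log_div (by positivity) hw.ne', Real.log_mul (by norm_num) (by positivity)]
  have e2 : Real.log 12 + Real.log 4 ≤ 6 * Real.log 2 := by
    rw [← Real.log_mul (by norm_num) (by norm_num),
      show 6 * Real.log 2 = ((6 : ℕ) : ℝ) * Real.log 2 by norm_num, ← Real.log_pow]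
    exact Real.log_le_log (by norm_num) (by norm_num)
  linarith

/-- The bound for a given network, once it holds for all centers. -/
lemma gap_le_of_centers {d C w N : ℕ} (hN : 0 < N) (F : LinearNetwork d C w) {lam R b E δ g : ℝ}
    (hlam : 0 ≤ lam) (hR : 0 ≤ R) (hlR : 0 < lam * R) (hRb : R ≤ b) (hE : 0 ≤ E) (hδ : 0 < δ)
    (hδ1 : δ < 1)
    (hg : ∀ α : CenterIndex C d, g ≤ 2 / √N * ((4 * (Nat.clog 2 N : ℝ) + 1) *
      (lam * R * (Real.log (2 * C + 2) + 1) * ‖vecOf F.toMatrix - vecOf (centerMatrix α)‖) +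
        10 * E * √(Real.log (12 / (δ / 2 * centerWeight α))))) :
    g ≤ 60 * E * √(Real.log (2 / δ) / N) + 160 * (E + 1) *
      polylogFactor 2 N C d lam b (spectralNorm2 F.toMatrix) *
        √(F.schattenRate (lam * b) / N) := by
  obtain ⟨α, h1, h2⟩ := exists_good_center hN F hlam hR hlR hRb
  have hb : 0 ≤ b := hR.trans hRb
  have hs0 := spectralNorm2_nonneg F.toMatrix
  have hT0 : 0 ≤ F.schattenRate (lam * b) := F.schattenRate_nonneg (by positivity)
  have hN1 : (1 : ℝ) ≤ N := by exact_mod_cast hN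
  have hC0 : (0 : ℝ) ≤ C := C.cast_nonneg
  have hd0 : (0 : ℝ) ≤ d := d.cast_nonneg
  refine (hg α).trans ?_
  unfold polylogFactor
  set T := F.schattenRate (lam * b)
  set q : ℝ := 3 + N + C + d + lam + b + spectralNorm2 F.toMatrix with hq
  set l := Real.log q with hl
  have hl1 : 1 ≤ l := by
    rw [hl, Real.le_log_iff_exp_le (by linarith)]
    have := Real.exp_one_lt_d9
    linarith
  have hclog : (Nat.clog 2 N : ℝ) ≤ 3 * l := clog_two_le (by rw [hq]; linarith) hl1
  have hKl : Real.log (2 * C + 2) + 1 ≤ 3 * l := by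
    have e1 : (2 * C + 2 : ℝ) ≤ q ^ 2 := by nlinarith
    have e2 := Real.log_le_log (by positivity) e1
    rw [Real.log_pow] at e2
    push_cast at e2
    linarith
  have hK0 : 0 ≤ Real.log (2 * C + 2) + 1 := by
    have := Real.log_nonneg (show (1 : ℝ) ≤ 2 * C + 2 by linarith)
    linarith
  have hc := log_confidence_le hδ hδ1 (centerWeight_pos α) h2
  set D := Real.log (2 / δ) with hD
  have hD0 : 0 ≤ D := (Real.log_nonneg (by norm_num)).trans (log_two_le_log_two_div hδ hδ1)
  have hsq : √(Real.log (12 / (δ / 2 * centerWeight α))) ≤ 3 * √D + 6 * (l * √T) := by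
    rw [Real.sqrt_le_left (by positivity)]
    refine hc.trans ?_
    have e1 : √D ^ 2 = D := Real.sq_sqrt hD0
    have e2 : √T ^ 2 = T := Real.sq_sqrt hT0
    have e3 : 0 ≤ √D * (l * √T) := by positivity
    have e4 : l * T ≤ l ^ 2 * T := by gcongr; nlinarith
    have e5 : 0 ≤ l * T := by positivity
    calc 7 * D + 26 * l * T ≤ 9 * D + 36 * (l ^ 2 * T) := by nlinarith
      _ ≤ 9 * √D ^ 2 + 36 * (l ^ 2 * √T ^ 2) + 36 * (√D * (l * √T)) := by
          rw [e1, e2]; linarith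
      _ = _ := by ring
  have hmain : (4 * (Nat.clog 2 N : ℝ) + 1) *
      (lam * R * (Real.log (2 * C + 2) + 1) * ‖vecOf F.toMatrix - vecOf (centerMatrix α)‖) ≤
      13 * l * (3 * l * (2 * √T)) := by
    rw [show lam * R * (Real.log (2 * C + 2) + 1) *
      ‖vecOf F.toMatrix - vecOf (centerMatrix α)‖ = (Real.log (2 * C + 2) + 1) *
      (lam * R * ‖vecOf F.toMatrix - vecOf (centerMatrix α)‖) by ring]
    gcongr
    linarith
  have hlT : l * √T ≤ l ^ 2 * √T := by gcongr; nlinarith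
  have hlT0 : 0 ≤ l ^ 2 * √T := by positivity
  calc _ ≤ 2 / √N * (13 * l * (3 * l * (2 * √T)) + 10 * E * (3 * √D + 6 * (l ^ 2 * √T))) := by
        gcongr
        exact hsq.trans (by linarith)
    _ = 1 / √N * (60 * E * √D + (156 + 120 * E) * (l ^ 2 * √T)) := by ring
    _ ≤ 1 / √N * (60 * E * √D + 160 * (E + 1) * (l ^ 2 * √T)) := by
        gcongr
        linarith
    _ = _ := by
        rw [Real.sqrt_div hD0, Real.sqrt_div hT0]
        ring

/-- If `lam * R = 0`, the truncated loss does not depend on the matrix. -/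
lemma truncLoss_eq_truncLoss_zero {d C : ℕ} {Y : Type*} {loss : (Fin C → ℝ) → Y → ℝ} {lam R : ℝ}
    (hlam : 0 ≤ lam) (hR : 0 ≤ R) (hlR : ¬ 0 < lam * R)
    (hlip : ∀ z z' y, |loss z y - loss z' y| ≤ lam * ‖z - z'‖) (u : MatVec C d) :
    truncLoss loss R u = truncLoss loss R 0 := by
  funext z
  unfold truncLoss
  split_ifs with hz
  · have h0 : lam * R = 0 := le_antisymm (not_lt.1 hlR) (by positivity)
    rcases mul_eq_zero.1 h0 with h | h
    · have := hlip (matOf u *ᵥ z.1.ofLp) (matOf 0 *ᵥ z.1.ofLp) z.2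
      rw [h, zero_mul] at this
      exact sub_eq_zero.1 (abs_nonpos_iff.1 this)
    · rw [h] at hz
      rw [norm_le_zero_iff.1 hz]
      simp
  · rfl

/-- The generalization bound with explicit constants. It can fail only if the sample radius is below
the quantile or the chained bound fails, each with probability at most `δ/2`. -/
lemma measure_generalization_le {d C N : ℕ} (hN : 0 < N) {Y : Type*} [MeasurableSpace Y]
    (D : Measure (EuclideanSpace ℝ (Fin d) × Y)) [IsProbabilityMeasure D]
    {loss : (Fin C → ℝ) → Y → ℝ} {lam E : ℝ} (hl : Measurable (Function.uncurry loss))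
    (hlam : 0 ≤ lam) (hE : ∀ z y, 0 ≤ loss z y ∧ loss z y ≤ E)
    (hlip : ∀ z z' y, |loss z y - loss z' y| ≤ lam * ‖z - z'‖) {δ : ℝ} (hδ : 0 < δ)
    (hδ1 : δ < 1) :
    Measure.pi (fun _ : Fin N => D) {S | ¬ ∀ (w : ℕ) (F : LinearNetwork d C w),
      genGap D loss S F.toMatrix - 61 * E * √(Real.log (2 / δ) / N) ≤
        160 * (E + 1) * polylogFactor 2 N C d lam (sampleRadius S) (spectralNorm2 F.toMatrix) *
          √(F.schattenRate (lam * sampleRadius S) / N)} ≤ ENNReal.ofReal δ := by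
  obtain ⟨z₀⟩ := nonempty_of_isProbabilityMeasure D
  have hE0 : 0 ≤ E := (hE 0 z₀.2).1.trans (hE 0 z₀.2).2
  have hN' : (0 : ℝ) < N := by exact_mod_cast hN
  have hlog := log_two_le_log_two_div hδ hδ1
  have hlog2 : 0 < Real.log 2 := Real.log_pos (by norm_num)
  set q := Real.log (2 / δ) / N with hq
  have hq0 : 0 < q := div_pos (hlog2.trans_le hlog) hN'
  have hrhs : ∀ (S : Fin N → EuclideanSpace ℝ (Fin d) × Y) (A : Matrix (Fin C) (Fin d) ℝ)
      (t : ℝ), 0 ≤ 160 * (E + 1) * polylogFactor 2 N C d lam (sampleRadius S) (spectralNorm2 A) *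
        √t := fun S A t => by
    unfold polylogFactor
    positivity
  by_cases htriv : E = 0 ∨ 1 ≤ q
  · -- The gap is at most `E`, so that the confidence term alone suffices.
    have : {S : Fin N → EuclideanSpace ℝ (Fin d) × Y | ¬ ∀ (w : ℕ) (F : LinearNetwork d C w),
        genGap D loss S F.toMatrix - 61 * E * √q ≤
        160 * (E + 1) * polylogFactor 2 N C d lam (sampleRadius S) (spectralNorm2 F.toMatrix) *
          √(F.schattenRate (lam * sampleRadius S) / N)} = ∅ := by
      refine Set.eq_empty_of_forall_notMem fun S hS => hS fun w F => ?_
      refine le_trans ?_ (hrhs S F.toMatrix _)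
      have h1 := genGap_le D hE S F.toMatrix
      rcases htriv with h | h
      · rw [h] at h1 ⊢
        simpa using h1
      · have h2 : 1 ≤ √q := Real.one_le_sqrt.2 h
        nlinarith
    rw [this, measure_empty]
    exact zero_le
  obtain ⟨hEne, hq1⟩ := not_or.1 htriv
  have hEpos : 0 < E := lt_of_le_of_ne hE0 (Ne.symm hEne)
  replace hq1 : q < 1 := not_le.1 hq1
  obtain ⟨R, hR0, hRge, hRgt⟩ := exists_quantile D
    (φ := fun z : EuclideanSpace ℝ (Fin d) × Y => ‖z.1‖) (by fun_prop) (fun _ => norm_nonneg _)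
    hq0 hq1.le
  -- If `lam * R = 0`, smoothing does not change the truncated loss and any positive rate serves.
  set κ : ℝ := if 0 < lam * R then lam * R * (Real.log (2 * C + 2) + 1) else 1 with hκdef
  have hK : 0 < Real.log (2 * C + 2) + 1 := by
    have := Real.log_nonneg (show (1 : ℝ) ≤ 2 * C + 2 by
      have : (0 : ℝ) ≤ C := C.cast_nonneg
      linarith)
    linarith
  have hκ : 0 < κ := by
    rw [hκdef]
    split_ifs with h
    · exact mul_pos h hK
    · exact one_pos
  have hsm : ∀ a, 0 ≤ a → ∀ u (z : EuclideanSpace ℝ (Fin d) × Y),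
      |truncLoss loss R u z - smooth a (truncLoss loss R) u z| ≤ κ * a := fun a ha u z => by
    refine (abs_truncLoss_sub_smooth_le hl hE0 hR0 hlam hE hlip ha u z).trans ?_
    rw [hκdef]
    split_ifs with h
    · exact le_rfl
    · have h0 : lam * R = 0 := le_antisymm (not_lt.1 h) (by positivity)
      rw [h0]
      simpa using ha
  have hev := measure_chaining_le hN D (measurable_truncLoss (d := d) hl R) hEpos
    (abs_truncLoss_le hE0 hE R) hκ hsm (fun α : CenterIndex C d => vecOf (centerMatrix α))
    centerWeight_pos centerWeight_le_one (tsum_centerWeight_le C d) (half_pos hδ) (by linarith)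
  have hrad := measure_sampleRadius_lt_le hN D hδ hRge
  have hδs : ENNReal.ofReal δ = ENNReal.ofReal (δ / 2) + ENNReal.ofReal (δ / 2) := by
    rw [← ENNReal.ofReal_add (by positivity) (by positivity), add_halves]
  rw [hδs]
  refine le_trans (le_trans (measure_mono fun S hS => ?_) (measure_union_le _ _))
    (add_le_add hrad hev)
  by_contra hcon
  simp only [Set.mem_union, Set.mem_ofPred_eq, not_or, not_not, not_lt] at hcon
  obtain ⟨hRS, hcent⟩ := hcon
  refine hS fun w F => ?_
  have hgap := genGap_le_empGap_truncLoss D hl hE0 hE hRgt S F.toMatrix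
  have hqs : E * q ≤ E * √q := by
    gcongr
    refine Real.le_sqrt_of_sq_le ?_
    nlinarith
  suffices h : empGap D S (truncLoss loss R (vecOf F.toMatrix)) ≤ 60 * E * √q + 160 * (E + 1) *
      polylogFactor 2 N C d lam (sampleRadius S) (spectralNorm2 F.toMatrix) *
        √(F.schattenRate (lam * sampleRadius S) / N) by
    linarith
  by_cases hlR : 0 < lam * R
  · refine gap_le_of_centers hN F hlam hR0 hlR hRS hE0 hδ hδ1 fun α => ?_
    have := (le_abs_self _).trans (hcent α (vecOf F.toMatrix))
    rwa [hκdef, if_pos hlR] at this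
  · rw [truncLoss_eq_truncLoss_zero hlam hR0 hlR hlip]
    have h1 := (le_abs_self _).trans
      (hcent ⟨(0, 0), fun _ l => l.elim0, fun l => l.elim0⟩ 0)
    have e1 : centerMatrix (⟨(0, 0), fun _ l => l.elim0, fun l => l.elim0⟩ : CenterIndex C d) =
        0 := by
      ext x y
      simp [centerMatrix]
    have e2 := log_confidence_le hδ hδ1 (centerWeight_pos
      (⟨(0, 0), fun _ l => l.elim0, fun l => l.elim0⟩ : CenterIndex C d)) (x := 0) (by
        rw [neg_log_centerWeight, show (4 : ℝ) = 2 ^ 2 by norm_num, Real.log_pow]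
        simp only [Nat.cast_zero, zero_add, zero_mul, add_zero, Nat.cast_ofNat]
        linarith)
    rw [e1, vecOf_zero, sub_zero, norm_zero, mul_zero, mul_zero, zero_add] at h1
    have e3 : √(Real.log (12 / (δ / 2 * centerWeight
        (⟨(0, 0), fun _ l => l.elim0, fun l => l.elim0⟩ : CenterIndex C d)))) ≤
        3 * √(Real.log (2 / δ)) := by
      rw [Real.sqrt_le_left (by positivity), mul_pow, Real.sq_sqrt (by linarith)]
      linarith
    refine h1.trans (le_trans ?_ (le_add_of_nonneg_right (hrhs S F.toMatrix _)))
    calc _ ≤ 2 / √N * (10 * E * (3 * √(Real.log (2 / δ)))) := by gcongr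
      _ = 60 * E * √q := by
        rw [hq, Real.sqrt_div (by linarith)]
        ring

theorem theorem3p1 :
    -- the generalization bound, with universal constants
    (∃ (c₁ c₂ : ℝ) (k : ℕ),
      ∀ (d C N : ℕ), 0 < N →
      ∀ (Y : Type*) [MeasurableSpace Y]
        (D : Measure (EuclideanSpace ℝ (Fin d) × Y)) [IsProbabilityMeasure D]
        (loss : (Fin C → ℝ) → Y → ℝ) (lam E : ℝ),
        Measurable (Function.uncurry loss) →
        0 ≤ lam →
        (∀ z y, 0 ≤ loss z y ∧ loss z y ≤ E) →
        (∀ z z' y, |loss z y - loss z' y| ≤ lam * ‖z - z'‖) →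
        ∀ δ : ℝ, 0 < δ → δ < 1 →
          Measure.pi (fun _ : Fin N => D)
            {S | ¬ ∀ (w : ℕ) (F : LinearNetwork d C w),
              genGap D loss S F.toMatrix - c₁ * E * √(Real.log (2 / δ) / N) ≤
                c₂ * (E + 1) *
                  polylogFactor k N C d lam (sampleRadius S) (spectralNorm2 F.toMatrix) *
                  √(F.schattenRate (lam * sampleRadius S) / N) ∧
              c₂ * (E + 1) *
                  polylogFactor k N C d lam (sampleRadius S) (spectralNorm2 F.toMatrix) *
                  √(F.schattenRate (lam * sampleRadius S) / N) ≤
                c₂ * (E + 1) *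
                  polylogFactor k N C d lam (sampleRadius S) (spectralNorm2 F.toMatrix) *
                  √(F.factorRate (lam * sampleRadius S) / N)}
            ≤ ENNReal.ofReal δ) ∧
    -- the variational identity with `p = 2 / L`
    (∀ (d C w L : ℕ), min C d ≤ w → 1 ≤ L → ∀ A : Matrix (Fin C) (Fin d) ℝ,
      IsLeast {t : ℝ | ∃ F : LinearNetwork d C w,
          F.depth = L ∧ F.toMatrix = A ∧ F.weightSq = t}
        ((L : ℝ) * schattenNorm (2 / (L : ℝ)) A ^ (2 / (L : ℝ)))) ∧
    -- the parameter-counting limit, for minimal factorizations of a fixed matrix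
    (∀ (d C w : ℕ), min C d ≤ w →
      ∀ (A : Matrix (Fin C) (Fin d) ℝ) (F : ℕ → LinearNetwork d C w),
        (∀ L, 1 ≤ L → (F L).depth = L ∧ (F L).toMatrix = A ∧
          ∀ G : LinearNetwork d C w, G.depth = L → G.toMatrix = A →
            (F L).weightSq ≤ G.weightSq) →
        Tendsto (fun L : ℕ => (F L).weightSq / (L : ℝ)) atTop (𝓝 (A.rank : ℝ)) ∧
        ∀ a : ℝ, 0 < a →
          Tendsto (fun L : ℕ => (F L).schattenRate a) atTop
            (𝓝 (((C : ℝ) + d) * (A.rank : ℝ))) ∧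
          Tendsto (fun L : ℕ => (F L).factorRate a) atTop
            (𝓝 (((C : ℝ) + d) * (A.rank : ℝ)))) := by
  refine ⟨⟨61, 160, 2, ?_⟩, ?_, fun d C w hw A F hF => tendsto_rates hw A F hF⟩
  · intro d C N hN Y _ D _ loss lam E hl hlam hE hlip δ hδ hδ1
    refine (measure_mono ?_).trans (measure_generalization_le hN D hl hlam hE hlip hδ hδ1)
    -- The second inequality holds for every sample.
    intro S hS hgap
    refine hS fun w F => ⟨hgap w F, ?_⟩
    obtain ⟨z₀⟩ := nonempty_of_isProbabilityMeasure D
    have hE0 : 0 ≤ E := (hE 0 z₀.2).1.trans (hE 0 z₀.2).2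
    have hrate := F.schattenRate_le_factorRate (mul_nonneg hlam (sampleRadius_nonneg S))
    refine mul_le_mul_of_nonneg_left (Real.sqrt_le_sqrt (by gcongr)) ?_
    unfold polylogFactor
    positivity
  · intro d C w L hw hL A
    exact isLeast_weightSq d C w L hw hL A
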